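/- Let $\mathcal C\in\{\mathsf{AC}^0,\mathsf{ACC},\mathsf{TC}^0,\mathsf{NC}^1,\mathsf{NC},\mathsf{P/poly}\}$ (non-uniform, polynomial size). The size of a circuit is its number of gates. Circuits for $\mathsf{AC}^0,\mathsf{ACC},\mathsf{TC}^0$ have unbounded fan-in AND, OR and NOT gates, for $\mathsf{ACC}$ also $\mathrm{MOD}_m$ gates for one fixed $m\ge 2$, for $\mathsf{TC}^0$ also MAJORITY gates; circuits for $\mathsf{NC}^1,\mathsf{NC},\mathsf{P/poly}$ have AND and OR gates of fan-in at most $2$ and NOT gates. For a depth parameter $d$, the depth of a circuit with $n$ inputs is at most $d$ for $\mathsf{AC}^0,\mathsf{ACC},\mathsf{TC}^0$, at most $d\log n+d$ for $\mathsf{NC}^1$, at most $d(\log n)^d+d$ for $\mathsf{NC}$, and unrestricted for $\mathsf{P/poly}$. The parameters $d$ and $m$ (where relevant) are always quantified together with the size parameter $k$. **Natural properties.** A $\mathsf P$-natural property $\mathcal P$ is a set of Boolean functions such that membership of $f:\{0,1\}^n\to\{0,1\}$ in $\mathcal P$ is decidable from the $2^n$-bit truth table of $f$ in time $\mathrm{poly}(2^n)$,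 and such that for all $n$, $\mathcal P$ contains at least a $1/2^{O(n)}$ fraction of all functions $\{0,1\}^n\to\{0,1\}$. It is io-useful (respectively, ae-useful) against $\mathcal C$ if for all $k,d,m$ there are infinitely many $n$ (respectively, for all but finitely many $n$) such that $\mathcal P$ contains some function on $n$ bits, and contains no function on $n$ bits that has a $\mathcal C$-circuit of size at most $n^k$ with parameters $d,m$. **Seeds.** Let $\mathsf{ZPE}=\mathsf{ZPTIME}[2^{O(n)}]$. A $\mathsf{ZPE}$ predicate for a language $L$ is a procedure $M(x,y)$, where for some constant $c$ depending on $M$ the string $y$ has length $2^{c|x|}$, which runs in time $\mathrm{poly}(|y|)\cdot 2^{O(|x|)}$, such that for every $x\in L$: $\Pr_y[M(x,y)=1]\ge 2/3$ and $M(x,y)\in\{1,{\bf ?}\}$ for all $y$; and for every $x\notin L$: $\Pr_y[M(x,y)=0]\ge 2/3$ and $M(x,y)\in\{0,{\bf ?}\}$ for all $y$. $\mathsf{ZPE}$ has $\mathcal C$ seeds for almost all (respectively, infinitely many) input lengths if for every $L$ and every $\mathsf{ZPE}$ predicate $M$ for $L$ there are $k,d,m$ such that for all but finitely many (respectively, for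 infinitely many) $n$, for every $x\in\{0,1\}^n$ there is a $\mathcal C$-circuit $C_x$ with $cn$ inputs, of size at most $n^k+k$ and with parameters $d,m$, whose truth table satisfies $M(x,tt(C_x))\ne{\bf ?}$. **Theorem.** For every such $\mathcal C$: 1. there is no $\mathsf P$-natural property io-useful against $\mathcal C$ if and only if $\mathsf{ZPE}$ has $\mathcal C$ seeds for almost all input lengths; 2. there is no $\mathsf P$-natural property ae-useful against $\mathcal C$ if and only if $\mathsf{ZPE}$ has $\mathcal C$ seeds for infinitely many input lengths. -/

import Mathlib

namespace NaturalSeeds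

/-! ### Boolean functions and truth tables -/

/-- Boolean functions on `n` bits. -/
abbrev BoolFun (n : ℕ) : Type := (Fin n → Bool) → Bool

/-- The `i`-th `n`-bit string in lexicographic order (the first bit is the most significant). -/
def lexString (n i : ℕ) : Fin n → Bool := fun j => i.testBit (n - 1 - (j : ℕ))

/-- The truth table `f(y₁) f(y₂) ⋯ f(y_{2ⁿ})`, the `yᵢ` in lexicographic order. -/
def tt {n : ℕ} (f : BoolFun n) : List Bool :=
  List.ofFn fun i : Fin (2 ^ n) => f (lexString n i)

/-! ### Boolean circuits -/

/-- Gates reading from wires in `w`. All but `not` have arbitrary fan-in here. -/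
inductive Gate (w : Type) : Type
  | not (a : w) : Gate w
  | and (as : List w) : Gate w
  | or (as : List w) : Gate w
  | maj (as : List w) : Gate w
  | mod (q : ℕ) (as : List w) : Gate w

namespace Gate

/-- The wires that a gate reads. -/
def wires {w : Type} : Gate w → List w
  | not a => [a]
  | and as => as
  | or as => as
  | maj as => as
  | mod _ as => as

/-- The value of a gate. `maj` is 1 if at least half of its inputs are 1, and `mod q` is 1 if the
number of its inputs that are 1 is not divisible by `q`. -/
def eval {w : Type} (v : w → Bool) : Gate w → Bool
  | not a => !(v a)
  | and as => as.all v
  | or as => as.any v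
  | maj as => decide (as.length ≤ 2 * as.countP v)
  | mod q as => decide (¬ q ∣ as.countP v)

end Gate

/-- The possible sources of a wire in a circuit with `n` inputs and `s` gates so far. -/
inductive Wire (n s : ℕ) : Type
  | input (i : Fin n) : Wire n s
  | const (b : Bool) : Wire n s
  | gate (j : Fin s) : Wire n s

/-- `Gates n s`: lists of `s` gates over `n` inputs in topological order, each gate reading
inputs, constants, and earlier gates (fan-out is unbounded). -/
inductive Gates (n : ℕ) : ℕ → Type
  | nil : Gates n 0
  | snoc {s : ℕ} (G : Gates n s) (g : Gate (Wire n s)) : Gates n (s + 1)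

/-- The value of a wire, given the input and the values of the gates. -/
def Wire.eval {n s : ℕ} (x : Fin n → Bool) (v : Fin s → Bool) : Wire n s → Bool
  | input i => x i
  | const b => b
  | gate j => v j

/-- The depth of a wire, given the depths of the gates. Inputs and constants have depth 0. -/
def Wire.depth {n s : ℕ} (d : Fin s → ℕ) : Wire n s → ℕ
  | input _ => 0
  | const _ => 0
  | gate j => d j

namespace Gates

/-- The values of all gates on the input `x`. -/
def vals {n : ℕ} (x : Fin n → Bool) : {s : ℕ} → Gates n s → Fin s → Bool
  | _, nil => Fin.elim0
  | _, snoc G g => Fin.snoc (α := fun _ => Bool) (vals x G) (g.eval (Wire.eval x (vals x G)))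

/-- The depths of all gates: one more than the maximal depth of a wire that the gate reads. -/
def depths {n : ℕ} : {s : ℕ} → Gates n s → Fin s → ℕ
  | _, nil => Fin.elim0
  | _, snoc G g => Fin.snoc (α := fun _ => ℕ) (depths G)
      ((g.wires.map (Wire.depth (depths G))).foldr max 0 + 1)

/-- All gates satisfy `B`. -/
def All {n : ℕ} (B : (w : Type) → Gate w → Prop) : {s : ℕ} → Gates n s → Prop
  | _, nil => True
  | _, snoc G g => All B G ∧ B _ g

end Gates

/-- A circuit with `n` inputs and one output. -/
structure Circuit (n : ℕ) where
  /-- the number of gates -/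
  size : ℕ
  gates : Gates n size
  out : Wire n size

/-- The Boolean function that a circuit computes. -/
def Circuit.eval {n : ℕ} (D : Circuit n) : BoolFun n :=
  fun x => D.out.eval x (D.gates.vals x)

/-- The length of a longest path from a source to the output. -/
def Circuit.depth {n : ℕ} (D : Circuit n) : ℕ := D.out.depth D.gates.depths

/-! ### The typical circuit classes -/

/-- The typical non-uniform circuit classes. -/
inductive TypicalClass : Type
  | AC0 | ACC | TC0 | NC1 | NC | Ppoly

namespace TypicalClass

/-- The gates allowed in each class, with `m` the modulus (relevant for `ACC` only): unbounded
fan-in for `AC0`, `ACC` and `TC0`, and fan-in at most two for `NC1`, `NC` and `Ppoly`. -/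
def Allows (C : TypicalClass) (m : ℕ) (w : Type) (g : Gate w) : Prop :=
  match C, g with
  | _, .not _ => True
  | AC0, .and _ => True
  | AC0, .or _ => True
  | ACC, .and _ => True
  | ACC, .or _ => True
  | ACC, .mod q _ => q = m ∧ 2 ≤ m
  | TC0, .and _ => True
  | TC0, .or _ => True
  | TC0, .maj _ => True
  | NC1, .and as => as.length ≤ 2
  | NC1, .or as => as.length ≤ 2
  | NC, .and as => as.length ≤ 2
  | NC, .or as => as.length ≤ 2
  | Ppoly, .and as => as.length ≤ 2
  | Ppoly, .or as => as.length ≤ 2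
  | _, _ => False

/-- The bound on the depth of circuits with `n` inputs and depth parameter `d`: constant for `AC0`,
`ACC` and `TC0`, `O(log n)` for `NC1`, polylogarithmic for `NC`, and none for `Ppoly`. -/
def depthBound (C : TypicalClass) (d n : ℕ) : ℕ∞ :=
  match C with
  | AC0 => (d : ℕ)
  | ACC => (d : ℕ)
  | TC0 => (d : ℕ)
  | NC1 => (d * Nat.log 2 n + d : ℕ)
  | NC => (d * Nat.log 2 n ^ d + d : ℕ)
  | Ppoly => ⊤

/-- `f` has a `C`-circuit of size at most `s`, with depth parameter `d` and modulus `m`. -/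
def HasCircuit (C : TypicalClass) (d m s : ℕ) {n : ℕ} (f : BoolFun n) : Prop :=
  ∃ D : Circuit n, D.size ≤ s ∧ D.gates.All (C.Allows m) ∧
    (D.depth : ℕ∞) ≤ C.depthBound d n ∧ D.eval = f

end TypicalClass

/-! ### Natural properties -/

/-- A property of Boolean functions. -/
abbrev BoolProperty : Type := (n : ℕ) → Set (BoolFun n)

open Classical in
/-- `P` is decidable in polynomial time, given truth tables: the running time is polynomial in the
length `2ⁿ` of the truth table. -/
def PConstructive (P : BoolProperty) : Prop :=
  Nonempty (Turing.TM2ComputableInPolyTime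
    (fun F : (n : ℕ) × BoolFun n => tt F.2) (fun b : Bool => [b])
    (fun F => decide (F.2 ∈ P F.1)))

/-- For all `n`, `P` contains at least a `1 / 2 ^ O(n)` fraction of the functions on `n` bits. -/
def Large (P : BoolProperty) : Prop :=
  ∃ d : ℕ, ∀ n : ℕ,
    1 / 2 ^ (d * n + d) ≤ (Nat.card (P n) : ℝ) / (Nat.card (BoolFun n) : ℝ)

/-- `P` holds for some function on `n` bits, and for none that has a `C`-circuit of size `n ^ k`,
depth parameter `d` and modulus `m`. -/
def UsefulAt (C : TypicalClass) (P : BoolProperty) (k d m n : ℕ) : Prop :=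
  (∃ f : BoolFun n, f ∈ P n) ∧ ∀ g : BoolFun n, C.HasCircuit d m (n ^ k) g → g ∉ P n

/-- Useful infinitely often. -/
def IOUseful (C : TypicalClass) (P : BoolProperty) : Prop :=
  ∀ k d m : ℕ, ∃ᶠ n in Filter.atTop, UsefulAt C P k d m n

/-- Useful almost everywhere. -/
def AEUseful (C : TypicalClass) (P : BoolProperty) : Prop :=
  ∀ k d m : ℕ, ∀ᶠ n in Filter.atTop, UsefulAt C P k d m n

/-- There is a P-natural property that is io-useful against `C`. -/
def ExistsIONatural (C : TypicalClass) : Prop :=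
  ∃ P : BoolProperty, PConstructive P ∧ Large P ∧ IOUseful C P

/-- There is a P-natural property that is ae-useful against `C`. -/
def ExistsAENatural (C : TypicalClass) : Prop :=
  ∃ P : BoolProperty, PConstructive P ∧ Large P ∧ AEUseful C P

/-! ### Zero-error exponential time and seeds -/

/-- The pair `(x, y)` as a single string over `{0, 1, separator}`. -/
def encodePair (x y : List Bool) : List (Option Bool) := x.map some ++ none :: y.map some

/-- `M (x, y)`, for `y` of length `2 ^ (c |x|)`, is computable by a Turing machine in time
`poly(|y|) * 2 ^ O(|x|)`. The machine writes `1`, `0`, or nothing for the output `?`. -/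
def ExpTimeComputable (c : ℕ) (M : List Bool → List Bool → Option Bool) : Prop :=
  ∃ (T : Turing.TM2ComputableAux (Option Bool) Bool) (p : Polynomial ℕ) (a : ℕ),
    ∀ x y : List Bool, y.length = 2 ^ (c * x.length) →
      Nonempty (Turing.TM2OutputsInTime T.tm
        ((encodePair x y).map T.inputAlphabet.symm)
        (some ((M x y).toList.map T.outputAlphabet.symm))
        (p.eval y.length * 2 ^ (a * x.length)))

/-- The probability that a uniformly random string of `N` bits satisfies `p`. -/
noncomputable def randProb (N : ℕ) (p : List Bool → Prop) : ℝ :=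
  (Nat.card {y : List.Vector Bool N // p y.toList} : ℝ) / 2 ^ N

/-- `M` is a ZPE predicate for the language `L`, with random strings `y` of length `2 ^ (c |x|)`.
The output `none` stands for `?`. -/
structure IsZPEPredicate (L : Set (List Bool)) (c : ℕ)
    (M : List Bool → List Bool → Option Bool) : Prop where
  time : ExpTimeComputable c M
  accept : ∀ x ∈ L, 2 / 3 ≤ randProb (2 ^ (c * x.length)) (fun y => M x y = some true) ∧
    ∀ y : List Bool, y.length = 2 ^ (c * x.length) → M x y = some true ∨ M x y = none
  reject : ∀ x ∉ L, 2 / 3 ≤ randProb (2 ^ (c * x.length)) (fun y => M x y = some false) ∧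
    ∀ y : List Bool, y.length = 2 ^ (c * x.length) → M x y = some false ∨ M x y = none

/-- Every `x` of length `n` has a seed: a string of length `2 ^ (c n)` on which `M` decides `x`, and
which is the truth table of a `C`-circuit of size at most `n ^ k + k`, depth parameter `d` and
modulus `m`. -/
def HasSeedsAt (C : TypicalClass) (c : ℕ) (M : List Bool → List Bool → Option Bool)
    (k d m n : ℕ) : Prop :=
  ∀ x : List Bool, x.length = n →
    ∃ f : BoolFun (c * n), C.HasCircuit d m (n ^ k + k) f ∧ M x (tt f) ≠ none

/-- ZPE has `C` seeds for almost all input lengths. -/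
def ZPEHasSeedsAE (C : TypicalClass) : Prop :=
  ∀ L c M, IsZPEPredicate L c M →
    ∃ k d m : ℕ, ∀ᶠ n in Filter.atTop, HasSeedsAt C c M k d m n

/-- ZPE has `C` seeds for infinitely many input lengths. -/
def ZPEHasSeedsIO (C : TypicalClass) : Prop :=
  ∀ L c M, IsZPEPredicate L c M →
    ∃ k d m : ℕ, ∃ᶠ n in Filter.atTop, HasSeedsAt C c M k d m n

end NaturalSeeds

/-! Natural properties and zero-error predicates translate into each other, and both halves of the
theorem are the same pair of translations with different quantifiers over the input length. Two
facts drive them. The truth table of a function on `a + b` bits is the concatenation of the truth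
tables of its `2 ^ a` restrictions by the first `a` bits (`tt_eq_flatten`); for a uniformly random
function these blocks are independent (`density_blocks`). And hardwiring those bits turns a small
circuit for the function into an equally small one for each block (`TypicalClass.HasCircuit.block`).

From a predicate `M` to a property (`seedProperty`): write `N = a + c * n` with `n = N / (c + 1)`,
and accept a function on `N` bits if every `x` of length `n` is decided by some block. A block fails
for a given `x` with probability at most `1 / 3`, there are `2 ^ a > n` independent blocks, and a
union bound over the `2 ^ n` strings leaves density at least `2 / 3`. If an accepted function has a
small circuit, its blocks are small-circuit seeds for all `x` of length `n`. So wherever seeds are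
missing at `n`, the property is useful at `N` (`exists_natural_of_predicate`).

From a property `P` to a predicate (`hardSearch`): the language consists of all strings, and `M`
accepts `(x, y)` if one of the blocks of `y` of length `2 ^ |x|` is the table of a function in `P`,
answering `?` otherwise. Largeness makes exponentially many blocks suffice for success probability
`2 / 3`. A seed with a small circuit contains a block in `P`, which then has a small circuit too, so
`P` is not useful at that length (`exists_predicate_of_natural`).

The running time claims concern concrete stack machines. They are proved with a small language of
structured programs, which can call a given machine as a subroutine and whose steps are counted;
`exists_search` and `exists_test` provide the two machines needed. -/

namespace NaturalSeeds

open Turing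

/-! ### Structured programs over stack machines -/

namespace Machine

/-- Names of the auxiliary stacks of Booleans. -/
inductive Aux : Type
  | A | B | R | S | X | Y | U | V | out
  deriving DecidableEq

instance : Fintype Aux := ⟨{.A, .B, .R, .S, .X, .Y, .U, .V, .out}, by intro j; cases j <;> decide⟩

/-- The finite memory of a program. -/
structure Reg : Type where
  cur : Option Bool
  found : Bool
  ok : Bool
  deriving Fintype

/-- The memory at the beginning and at the end of a computation. -/
def Reg.init : Reg := ⟨none, false, false⟩

/-- Structured programs which may run a given machine as a subroutine. The type `ι` is the input
alphabet, and `γ₀`, `γ₁` are the alphabets of the input and output stacks of the subroutine. -/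
inductive Prog (ι γ₀ γ₁ : Type) : Type
  | push (j : Aux) (f : Reg → Bool)
  | pop (j : Aux) (f : Reg → Option Bool → Reg)
  | peek (j : Aux) (f : Reg → Option Bool → Reg)
  | read (f : Reg → Option ι → Reg)
  | load (f : Reg → Reg)
  | feed (f : Reg → γ₀)
  | call (f : Reg → Option γ₁ → Reg)
  | seq (p q : Prog ι γ₀ γ₁)
  | ite (b : Reg → Bool) (p q : Prog ι γ₀ γ₁)
  | loop (b : Reg → Bool) (p : Prog ι γ₀ γ₁)

variable (tm : FinTM2) (ι : Type)

/-- The programs which may call `tm`. -/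
abbrev Program : Type := Prog ι (tm.Γ tm.k₀) (tm.Γ tm.k₁)

/-- The stacks of a compiled program. -/
inductive Stk (κ : Type) : Type
  | inp
  | aux (j : Aux)
  | sub (k : κ)
  deriving DecidableEq, Fintype

/-- The alphabets of the stacks of a compiled program. -/
def Alph : Stk tm.K → Type
  | .inp => ι
  | .aux _ => Bool
  | .sub k => tm.Γ k

/-- The labels of a compiled program. -/
def Lbl {tm : FinTM2} {ι : Type} : Program tm ι → Type
  | .call _ => Option tm.Λ
  | .seq p q => Lbl p ⊕ Lbl q
  | .ite _ p q => Option (Lbl p ⊕ Lbl q)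
  | .loop _ p => Option (Lbl p)
  | _ => Unit

instance Lbl.fintype {tm : FinTM2} {ι : Type} : (p : Program tm ι) → Fintype (Lbl p)
  | .call _ => letI := tm.ΛFin; inferInstanceAs (Fintype (Option tm.Λ))
  | .seq p q =>
    letI := Lbl.fintype p; letI := Lbl.fintype q; inferInstanceAs (Fintype (Lbl p ⊕ Lbl q))
  | .ite _ p q =>
    letI := Lbl.fintype p; letI := Lbl.fintype q
    inferInstanceAs (Fintype (Option (Lbl p ⊕ Lbl q)))
  | .loop _ p => letI := Lbl.fintype p; inferInstanceAs (Fintype (Option (Lbl p)))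
  | .push _ _ => inferInstanceAs (Fintype Unit)
  | .pop _ _ => inferInstanceAs (Fintype Unit)
  | .peek _ _ => inferInstanceAs (Fintype Unit)
  | .read _ => inferInstanceAs (Fintype Unit)
  | .load _ => inferInstanceAs (Fintype Unit)
  | .feed _ => inferInstanceAs (Fintype Unit)

/-- The label at which the execution of a program starts. -/
def entry {tm : FinTM2} {ι : Type} : (p : Program tm ι) → Lbl p
  | .call _ => some tm.main
  | .seq p _ => .inl (entry p)
  | .ite _ _ _ => none
  | .loop _ _ => none
  | .push _ _ => ()
  | .pop _ _ => ()
  | .peek _ _ => ()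
  | .read _ => ()
  | .load _ => ()
  | .feed _ => ()

/-- The statements of the compiled programs. -/
abbrev St (Λ : Type) : Type := TM2.Stmt (Alph tm ι) Λ (Reg × tm.σ)

variable {tm ι}

/-- A statement of the subroutine as a statement of the calling program. -/
def embed {Λ : Type} (lab : tm.Λ → Λ) (exit : Λ) : TM2.Stmt tm.Γ tm.Λ tm.σ → St tm ι Λ
  | .push k f q => .push (.sub k) (fun v => f v.2) (embed lab exit q)
  | .peek k f q => .peek (.sub k) (fun v o => (v.1, f v.2 o)) (embed lab exit q)
  | .pop k f q => .pop (.sub k) (fun v o => (v.1, f v.2 o)) (embed lab exit q)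
  | .load f q => .load (fun v => (v.1, f v.2)) (embed lab exit q)
  | .branch b q r => .branch (fun v => b v.2) (embed lab exit q) (embed lab exit r)
  | .goto f => .goto fun v => lab (f v.2)
  | .halt => .goto fun _ => exit

/-- Compilation, with `lab` the embedding of the labels, and `exit` the label to go to at the
end. -/
def compile {Λ : Type} : (p : Program tm ι) → (Lbl p → Λ) → Λ → Lbl p → St tm ι Λ
  | .push j f, _, e, _ => .push (.aux j) (fun v => f v.1) (.goto fun _ => e)
  | .pop j f, _, e, _ => .pop (.aux j) (fun v o => (f v.1 o, v.2)) (.goto fun _ => e)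
  | .peek j f, _, e, _ => .peek (.aux j) (fun v o => (f v.1 o, v.2)) (.goto fun _ => e)
  | .read f, _, e, _ => .pop .inp (fun v o => (f v.1 o, v.2)) (.goto fun _ => e)
  | .load f, _, e, _ => .load (fun v => (f v.1, v.2)) (.goto fun _ => e)
  | .feed f, _, e, _ => .push (.sub tm.k₀) (fun v => f v.1) (.goto fun _ => e)
  | .call _, lab, _, some l => embed (fun l' => lab (some l')) (lab none) (tm.m l)
  | .call f, _, e, none => .pop (.sub tm.k₁) (fun v o => (f v.1 o, v.2)) (.goto fun _ => e)
  | .seq p q, lab, _, .inl l => compile p (fun l' => lab (.inl l')) (lab (.inr (entry q))) l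
  | .seq _ q, lab, e, .inr l => compile q (fun l' => lab (.inr l')) e l
  | .ite b p q, lab, _, none =>
    .branch (fun v => b v.1) (.goto fun _ => lab (some (.inl (entry p))))
      (.goto fun _ => lab (some (.inr (entry q))))
  | .ite _ p _, lab, e, some (.inl l) => compile p (fun l' => lab (some (.inl l'))) e l
  | .ite _ _ q, lab, e, some (.inr l) => compile q (fun l' => lab (some (.inr l'))) e l
  | .loop b p, lab, e, none =>
    .branch (fun v => b v.1) (.goto fun _ => lab (some (entry p))) (.goto fun _ => e)
  | .loop _ p, lab, _, some l => compile p (fun l' => lab (some l')) (lab none) l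

/-! ### Semantics -/

/-- The state of a program: the memory, the input, the auxiliary stacks, and the input that has
been prepared for the subroutine. -/
structure State (tm : FinTM2) (ι : Type) : Type where
  reg : Reg
  inp : List ι
  stk : Aux → List Bool
  sub : List (tm.Γ tm.k₀)

/-- The stacks of the machine in a given state. -/
def stks (inp : List ι) (stk : Aux → List Bool) (Q : ∀ k, List (tm.Γ k)) :
    ∀ k, List (Alph tm ι k)
  | .inp => inp
  | .aux j => stk j
  | .sub k => Q k

/-- The stacks that are empty with the exception of one. -/
def single {K : Type} [DecidableEq K] {Γ : K → Type} (k : K) (l : List (Γ k)) : ∀ k, List (Γ k) :=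
  Function.update (fun _ => []) k l

theorem update_single {K : Type} [DecidableEq K] {Γ : K → Type} (k : K) (l l' : List (Γ k)) :
    Function.update (single k l) k l' = single k l' :=
  Function.update_idem _ _ _

theorem single_self {K : Type} [DecidableEq K] {Γ : K → Type} (k : K) (l : List (Γ k)) :
    single k l k = l :=
  Function.update_self _ _ _

theorem single_nil {K : Type} [DecidableEq K] {Γ : K → Type} (k : K) :
    single (Γ := Γ) k [] = fun _ => [] :=
  Function.update_eq_self k fun _ => []

/-- The configuration of the machine in a given state. -/
def State.cfg {Λ : Type} (c : State tm ι) (l : Λ) : TM2.Cfg (Alph tm ι) Λ (Reg × tm.σ) :=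
  ⟨some l, (c.reg, tm.initialState), stks c.inp c.stk (single tm.k₀ c.sub)⟩

/-- `f` leads from `a` to `b` in at most `t` steps. -/
def Runs {α : Type} (f : α → Option α) (a b : α) (t : ℕ) : Prop :=
  ∃ s ≤ t, (flip bind f)^[s] (some a) = some b

theorem Runs.refl {α : Type} (f : α → Option α) (a : α) : Runs f a a 0 := ⟨0, le_rfl, rfl⟩

theorem Runs.single {α : Type} {f : α → Option α} {a b : α} (h : f a = some b) : Runs f a b 1 :=
  ⟨1, le_rfl, h⟩

theorem Runs.mono {α : Type} {f : α → Option α} {a b : α} {s t : ℕ} (h : Runs f a b s)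
    (hst : s ≤ t) : Runs f a b t := by
  obtain ⟨r, hr, h⟩ := h
  exact ⟨r, hr.trans hst, h⟩

theorem Runs.trans {α : Type} {f : α → Option α} {a b c : α} {s t : ℕ} (h : Runs f a b s)
    (h' : Runs f b c t) : Runs f a c (s + t) := by
  obtain ⟨r, hr, h⟩ := h
  obtain ⟨r', hr', h'⟩ := h'
  exact ⟨r' + r, by omega, by rw [Function.iterate_add_apply, h, h']⟩

/-- The program `p` leads from `c` to `c'` in at most `t` steps. -/
def Does (p : Program tm ι) (t : ℕ) (c c' : State tm ι) : Prop :=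
  ∀ (Λ : Type) (M : Λ → St tm ι Λ) (lab : Lbl p → Λ) (e : Λ),
    (∀ l, M (lab l) = compile p lab e l) → Runs (TM2.step M) (c.cfg (lab (entry p))) (c'.cfg e) t

theorem update_stks_inp (inp inp' : List ι) (stk : Aux → List Bool) (Q : ∀ k, List (tm.Γ k)) :
    Function.update (stks inp stk Q) .inp inp' = stks inp' stk Q := by
  funext k
  cases k <;> rfl

theorem update_stks_aux (inp : List ι) (stk : Aux → List Bool) (Q : ∀ k, List (tm.Γ k))
    (j : Aux) (l : List Bool) : Function.update (stks inp stk Q) (.aux j) l =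
      stks inp (Function.update stk j l) Q := by
  funext k
  rcases k with _ | i | k
  · rfl
  · by_cases h : i = j
    · subst h
      exact (Function.update_self _ _ _).trans (Function.update_self (β := fun _ : Aux => List Bool) _ l stk).symm
    · exact (Function.update_of_ne (by simpa using h) _ _).trans
        (Function.update_of_ne (β := fun _ : Aux => List Bool) h l stk).symm
  · rfl

theorem update_stks_sub (inp : List ι) (stk : Aux → List Bool) (Q : ∀ k, List (tm.Γ k))
    (k : tm.K) (l : List (tm.Γ k)) : Function.update (stks inp stk Q) (.sub k) l =
      stks inp stk (Function.update Q k l) := by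
  funext i
  rcases i with _ | i | i
  · rfl
  · rfl
  · by_cases h : i = k
    · subst h
      exact (Function.update_self _ _ _).trans (Function.update_self (β := fun k => List (tm.Γ k)) _ l Q).symm
    · exact (Function.update_of_ne (by simpa using h) _ _).trans
        (Function.update_of_ne (β := fun k => List (tm.Γ k)) h l Q).symm

theorem Does.mono {p : Program tm ι} {s t : ℕ} {c c' : State tm ι} (h : Does p s c c')
    (hst : s ≤ t) : Does p t c c' :=
  fun Λ M lab e hM => (h Λ M lab e hM).mono hst

theorem step_eq {Λ : Type} {M : Λ → St tm ι Λ} {l : Λ} {q : St tm ι Λ} (h : M l = q)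
    (v : Reg × tm.σ) (S : ∀ k, List (Alph tm ι k)) :
    TM2.step M ⟨some l, v, S⟩ = some (TM2.stepAux q v S) := by
  rw [TM2.step, h]

theorem Does.of {p : Program tm ι} {s t : ℕ} {c c' c'' : State tm ι} (h : Does p s c c')
    (hc : c' = c'') (hst : s ≤ t) : Does p t c c'' :=
  hc ▸ h.mono hst

theorem does_push (j : Aux) (f : Reg → Bool) (c : State tm ι) :
    Does (.push j f) 1 c { c with stk := Function.update c.stk j (f c.reg :: c.stk j) } := by
  intro Λ M lab e hM
  apply Runs.single
  simp only [State.cfg, TM2.step, hM, compile, TM2.stepAux]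
  erw [update_stks_aux]
  rfl

theorem does_pop (j : Aux) (f : Reg → Option Bool → Reg) (c : State tm ι) :
    Does (.pop j f) 1 c { c with
      reg := f c.reg (c.stk j).head?
      stk := Function.update c.stk j (c.stk j).tail } := by
  intro Λ M lab e hM
  apply Runs.single
  simp only [State.cfg, TM2.step, hM, compile, TM2.stepAux]
  erw [update_stks_aux]
  rfl

theorem does_peek (j : Aux) (f : Reg → Option Bool → Reg) (c : State tm ι) :
    Does (.peek j f) 1 c { c with reg := f c.reg (c.stk j).head? } := by
  intro Λ M lab e hM
  apply Runs.single
  simp only [State.cfg, TM2.step, hM, compile, TM2.stepAux]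
  rfl

theorem does_read (f : Reg → Option ι → Reg) (c : State tm ι) :
    Does (.read f) 1 c { c with reg := f c.reg c.inp.head?, inp := c.inp.tail } := by
  intro Λ M lab e hM
  apply Runs.single
  simp only [State.cfg, TM2.step, hM, compile, TM2.stepAux]
  erw [update_stks_inp]
  rfl

theorem does_load (f : Reg → Reg) (c : State tm ι) :
    Does (.load f) 1 c { c with reg := f c.reg } := by
  intro Λ M lab e hM
  apply Runs.single
  simp only [State.cfg, TM2.step, hM, compile, TM2.stepAux]

theorem does_feed (f : Reg → tm.Γ tm.k₀) (c : State tm ι) :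
    Does (.feed f) 1 c { c with sub := f c.reg :: c.sub } := by
  intro Λ M lab e hM
  apply Runs.single
  simp only [State.cfg, TM2.step, hM, compile, TM2.stepAux]
  erw [update_stks_sub]
  exact congrArg (fun Q => some (TM2.Cfg.mk _ _ (stks _ _ Q))) (update_single tm.k₀ c.sub _ |>.trans
    (congrArg (fun l => single _ (_ :: l)) (single_self tm.k₀ c.sub)))

/-- The subroutine touches only its own stacks and its own half of the memory. Its `halt` becomes a
jump to `e`, so a halted configuration corresponds to the label `e`. -/
theorem stepAux_embed {Λ : Type} (lab : tm.Λ → Λ) (e : Λ) (q : TM2.Stmt tm.Γ tm.Λ tm.σ) (r : Reg)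
    (v : tm.σ) (inp : List ι) (stk : Aux → List Bool) (Q : ∀ k, List (tm.Γ k)) :
    TM2.stepAux (embed lab e q) (r, v) (stks inp stk Q) =
      ⟨some ((TM2.stepAux q v Q).l.elim e lab), (r, (TM2.stepAux q v Q).var),
        stks inp stk (TM2.stepAux q v Q).stk⟩ := by
  induction q generalizing v Q with
  | push k f q ih => simp only [embed, TM2.stepAux]; erw [update_stks_sub]; exact ih _ _
  | peek k f q ih => simp only [embed, TM2.stepAux]; exact ih _ _
  | pop k f q ih => simp only [embed, TM2.stepAux]; erw [update_stks_sub]; exact ih _ _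
  | load f q ih => simp only [embed, TM2.stepAux]; exact ih _ _
  | branch b q q' ih ih' =>
    simp only [embed, TM2.stepAux]
    cases b v
    · exact ih' _ _
    · exact ih _ _
  | goto f => rfl
  | halt => rfl

theorem iterate_bind_none {α : Type} (f : α → Option α) (s : ℕ) :
    (flip bind f)^[s] none = none := by
  induction s with
  | zero => rfl
  | succ s ih => rw [Function.iterate_succ_apply]; exact ih

theorem runs_embed {Λ : Type} {M : Λ → St tm ι Λ} {lab : tm.Λ → Λ} {e : Λ}
    (hM : ∀ l, M (lab l) = embed lab e (tm.m l)) (r : Reg) (inp : List ι)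
    (stk : Aux → List Bool) (s : ℕ) (a b : tm.Cfg)
    (h : (flip bind tm.step)^[s] (some a) = some b) :
    Runs (TM2.step M) ⟨some (a.l.elim e lab), (r, a.var), stks inp stk a.stk⟩
      ⟨some (b.l.elim e lab), (r, b.var), stks inp stk b.stk⟩ s := by
  induction s generalizing a with
  | zero =>
    obtain rfl : a = b := by simpa using h
    exact Runs.refl _ _
  | succ s ih =>
    rw [Function.iterate_succ_apply] at h
    obtain ⟨_ | l, v, Q⟩ := a
    -- A halted machine has no further step, so a run with a final configuration cannot pass through
    -- a halt earlier.
    · erw [iterate_bind_none] at h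
      cases h
    · have h' := ih (TM2.stepAux (tm.m l) v Q) h
      rw [Nat.add_comm]
      refine Runs.trans (Runs.single ?_) h'
      simp only [Option.elim_some, TM2.step, hM]
      rw [stepAux_embed]

theorem initList_eq (l : List (tm.Γ tm.k₀)) :
    initList tm l = ⟨some tm.main, tm.initialState, single tm.k₀ l⟩ := by
  unfold initList
  congr 1
  funext k
  by_cases h : k = tm.k₀
  · subst h; simp [single]
  · simp [single, h]

theorem haltList_eq (l : List (tm.Γ tm.k₁)) :
    haltList tm l = ⟨none, tm.initialState, single tm.k₁ l⟩ := by
  unfold haltList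
  congr 1
  funext k
  by_cases h : k = tm.k₁
  · subst h; simp [single]
  · simp [single, h]

/-- A machine that outputs a list ends in its initial internal state with all stacks empty except
the output stack. Popping an output of at most one symbol therefore restores the clean configuration
built into `State.cfg`, and the subroutine can be called again. -/
theorem does_call (f : Reg → Option (tm.Γ tm.k₁) → Reg) (c : State tm ι)
    (o : Option (tm.Γ tm.k₁)) (t : ℕ) (h : Nonempty (TM2OutputsInTime tm c.sub (some o.toList) t)) :
    Does (.call f) (t + 1) c { c with reg := f c.reg o, sub := [] } := by
  intro Λ M lab e hM
  obtain ⟨⟨s, hs⟩, hst⟩ := h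
  rw [Option.map_some, initList_eq, haltList_eq] at hs
  have h1 := runs_embed (M := M) (lab := fun l => lab (some l)) (e := lab none)
    (fun l => hM (some l)) c.reg c.inp c.stk s _ _ hs
  refine (h1.mono hst).trans (Runs.single ?_)
  refine (step_eq (hM none) _ _).trans ?_
  refine congrArg some ?_
  refine (congrArg (TM2.Cfg.mk _ _) (update_stks_sub _ _ _ _ _)).trans ?_
  have h2 := (update_single tm.k₁ o.toList o.toList.tail).trans
    ((congrArg _ (by cases o <;> rfl)).trans ((single_nil tm.k₁).trans (single_nil tm.k₀).symm))
  have h3 : o.toList.head? = o := by cases o <;> rfl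
  have h4 : stks (ι := ι) c.inp c.stk (single tm.k₁ o.toList) (.sub tm.k₁) = o.toList :=
    single_self tm.k₁ o.toList
  rw [h4]
  exact (congrArg (fun Q => TM2.Cfg.mk _ _ (stks c.inp c.stk Q)) h2).trans (h3.symm ▸ rfl)

/-- Composition is immediate because `Does` quantifies over all host machines, label embeddings and
exits: the exit of `p` is instantiated with the entry of `q`. The rules for branches and loops work
in the same way. -/
theorem Does.seq {p q : Program tm ι} {s t : ℕ} {c c' c'' : State tm ι} (h : Does p s c c')
    (h' : Does q t c' c'') : Does (.seq p q) (s + t) c c'' := by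
  intro Λ M lab e hM
  exact (h Λ M _ _ fun l => hM (.inl l)).trans (h' Λ M _ _ fun l => hM (.inr l))

theorem Does.ite_true {b : Reg → Bool} {p q : Program tm ι} {t : ℕ} {c c' : State tm ι}
    (hb : b c.reg = true) (h : Does p t c c') : Does (.ite b p q) (t + 1) c c' := by
  intro Λ M lab e hM
  rw [Nat.add_comm]
  refine Runs.trans (Runs.single ?_) (h Λ M _ _ fun l => hM (some (.inl l)))
  refine (step_eq (hM none) _ _).trans ?_
  simp only [compile, TM2.stepAux, hb, cond_true]
  rfl

theorem Does.ite_false {b : Reg → Bool} {p q : Program tm ι} {t : ℕ} {c c' : State tm ι}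
    (hb : b c.reg = false) (h : Does q t c c') : Does (.ite b p q) (t + 1) c c' := by
  intro Λ M lab e hM
  rw [Nat.add_comm]
  refine Runs.trans (Runs.single ?_) (h Λ M _ _ fun l => hM (some (.inr l)))
  refine (step_eq (hM none) _ _).trans ?_
  simp only [compile, TM2.stepAux, hb, cond_false]
  rfl

theorem Does.loop_true {b : Reg → Bool} {p : Program tm ι} {s t : ℕ} {c c' c'' : State tm ι}
    (hb : b c.reg = true) (h : Does p s c c') (h' : Does (.loop b p) t c' c'') :
    Does (.loop b p) (s + 1 + t) c c'' := by
  intro Λ M lab e hM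
  rw [Nat.add_comm s]
  refine Runs.trans (Runs.trans (Runs.single ?_) (h Λ M _ _ fun l => hM (some l)))
    (h' Λ M lab e hM)
  refine (step_eq (hM none) _ _).trans ?_
  simp only [compile, TM2.stepAux, hb, cond_true]
  rfl

theorem does_loop_false {b : Reg → Bool} {p : Program tm ι} {c : State tm ι}
    (hb : b c.reg = false) : Does (.loop b p) 1 c c := by
  intro Λ M lab e hM
  refine Runs.single ?_
  refine (step_eq (hM none) _ _).trans ?_
  simp only [compile, TM2.stepAux, hb, cond_false]
  rfl

/-- Does a program for every element of a list: `next` fetches an element, or recognizes the end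
of the list. -/
def forEach (next body : Program tm ι) : Program tm ι :=
  .seq next (.loop (fun r => r.cur.isSome) (.seq body next))

/-- The rule for iteration over a list: `st l a o` is the state before an element is fetched, with
`l` still to come, accumulator `a` and a stale symbol `o` in the register; `mid` is the state after
a fetch, and `fin` the one after the end is noticed. Each element costs the body, a fetch and a loop
test. -/
theorem does_forEach {β α : Type} {next body : Program tm ι} (inv : List β → α → Prop)
    (st : List β → α → Option Bool → State tm ι) (mid : β → List β → α → State tm ι)
    (fin : α → State tm ι) (g : α → β → α) (t : ℕ)
    (hnext : ∀ b l a o, inv (b :: l) a → Does next 1 (st (b :: l) a o) (mid b l a))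
    (hsome : ∀ b l a, (mid b l a).reg.cur.isSome = true)
    (hnil : ∀ a o, Does next 1 (st [] a o) (fin a))
    (hnone : ∀ a, (fin a).reg.cur.isSome = false)
    (hbody : ∀ b l a, inv (b :: l) a →
      inv l (g a b) ∧ ∃ o, Does body t (mid b l a) (st l (g a b) o))
    (l : List β) (a : α) (o : Option Bool) (hl : inv l a) :
    Does (forEach next body) (l.length * (t + 2) + 2) (st l a o) (fin (l.foldl g a)) := by
  have hloop : ∀ (l : List β) (b : β) (a : α), inv (b :: l) a →
      Does (tm := tm) (ι := ι) (.loop (fun r => r.cur.isSome) (.seq body next))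
        ((l.length + 1) * (t + 2) + 1) (mid b l a) (fin (l.foldl g (g a b))) := by
    intro l
    induction l with
    | nil =>
      intro b a h
      obtain ⟨-, o, ho⟩ := hbody b [] a h
      exact (Does.loop_true (hsome b [] a) (ho.seq (hnil _ o))
        (does_loop_false (hnone _))).mono (by simp)
    | cons b' l ih =>
      intro b a h
      obtain ⟨hi, o, ho⟩ := hbody b (b' :: l) a h
      refine (Does.loop_true (hsome b _ a) (ho.seq (hnext b' l _ o hi)) (ih b' _ hi)).mono ?_
      simp only [List.length_cons]
      ring_nf
      omega
  cases l with
  | nil => exact (hnil a o).seq (does_loop_false (hnone a)) |>.mono (by simp)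
  | cons b l =>
    exact ((hnext b l a o hl).seq (hloop l b a hl)).mono (by simp; omega)

theorem does_loop_iterate {b : Reg → Bool} {p : Program tm ι} (st : ℕ → State tm ι) (t n : ℕ)
    (hbody : ∀ i < n, b (st i).reg = true ∧ Does p t (st i) (st (i + 1)))
    (hend : b (st n).reg = false) : Does (.loop b p) (n * (t + 1) + 1) (st 0) (st n) := by
  induction n generalizing st with
  | zero => exact (does_loop_false hend).mono (by omega)
  | succ n ih =>
    have h := hbody 0 (by omega)
    refine (Does.loop_true h.1 h.2 (ih (fun i => st (i + 1)) (fun i hi => hbody _ (by omega))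
      hend)).mono ?_
    ring_nf
    omega

/-- Repeats a program. -/
def rep (p : Program tm ι) : ℕ → Program tm ι
  | 0 => .load id
  | n + 1 => .seq p (rep p n)

/-- The number of repetitions is fixed in the program text, so no counter and no loop test is
involved. -/
theorem does_rep {p : Program tm ι} (st : ℕ → State tm ι) (t n : ℕ)
    (h : ∀ i < n, Does p t (st i) (st (i + 1))) : Does (rep p n) (n * t + 1) (st 0) (st n) := by
  induction n generalizing st with
  | zero => exact (does_load id (st 0)).mono (by omega)
  | succ n ih =>
    refine ((h 0 (by omega)).seq (ih (fun i => st (i + 1)) fun i hi => h _ (by omega))).mono ?_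
    ring_nf
    omega

/-! ### The machine of a program -/

/-- The machine that executes a program. -/
def machine [Fintype ι] (p : Program tm ι) : FinTM2 :=
  letI := tm.kFin
  letI := tm.σFin
  { K := Stk tm.K
    k₀ := .inp
    k₁ := .aux .out
    Γ := Alph tm ι
    Λ := Option (Lbl p)
    main := some (entry p)
    σ := Reg × tm.σ
    initialState := (Reg.init, tm.initialState)
    Γk₀Fin := inferInstanceAs (Fintype ι)
    m := fun l => l.elim .halt (compile p some none) }

/-- The machine of a program, with its alphabets. -/
def computer [Fintype ι] (p : Program tm ι) : TM2ComputableAux ι Bool where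
  tm := machine p
  inputAlphabet := Equiv.refl _
  outputAlphabet := Equiv.refl _

/-- Halting with an output requires the initial memory and empty stacks apart from the output, so a
program has to clean up after itself. The extra step executes `halt`. -/
theorem computer_outputs [Fintype ι] {p : Program tm ι} {inp : List ι} {out : List Bool} {t : ℕ}
    (h : Does p t ⟨Reg.init, inp, fun _ => [], []⟩
      ⟨Reg.init, [], Function.update (fun _ => []) .out out, []⟩) {t' : ℕ} (ht : t + 1 ≤ t') :
    Nonempty (TM2OutputsInTime (computer p).tm (inp.map (computer p).inputAlphabet.symm)
      (some (out.map (computer p).outputAlphabet.symm)) t') := by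
  obtain ⟨s, hs, h⟩ := (h (Option (Lbl p)) (machine p).m some none fun l => rfl).trans
    (b := State.cfg _ _) (t := 1) (c := ⟨none, (Reg.init, tm.initialState), _⟩)
    (Runs.single rfl)
  refine ⟨⟨⟨s, ?_⟩, hs.trans ht⟩⟩
  rw [Option.map_some, initList_eq, haltList_eq]
  have h1 : stks (tm := tm) inp (fun _ => []) (single tm.k₀ []) =
      single (K := Stk tm.K) .inp inp := by
    rw [single_nil]
    funext k
    cases k <;> rfl
  have h2 : stks (tm := tm) (ι := ι) [] (Function.update (fun _ => []) .out out)
      (single tm.k₀ []) = single (K := Stk tm.K) (.aux .out) out := by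
    rw [single_nil]
    exact (update_stks_aux _ _ _ _ _).symm.trans (congrArg (fun S => Function.update S _ _)
      (by funext k; cases k <;> rfl))
  simp only [State.cfg, h1, h2] at h
  have e1 : inp.map (computer p).inputAlphabet.symm = inp := List.map_id inp
  have e2 : out.map (computer p).outputAlphabet.symm = out := List.map_id out
  rw [e1, e2]
  exact h

end Machine

end NaturalSeeds

namespace NaturalSeeds

open Turing

namespace Machine

/-! ### Basic programs -/

section

variable {tm : FinTM2} {ι : Type}

/-- The contents of the auxiliary stacks. -/
def conts (A B R S X Y U V O : List Bool) : Aux → List Bool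
  | .A => A
  | .B => B
  | .R => R
  | .S => S
  | .X => X
  | .Y => Y
  | .U => U
  | .V => V
  | .out => O

section

variable (A B R S X Y U V O l : List Bool)

@[simp] theorem update_A : Function.update (conts A B R S X Y U V O) .A l =
    conts l B R S X Y U V O := by funext j; cases j <;> rfl
@[simp] theorem update_B : Function.update (conts A B R S X Y U V O) .B l =
    conts A l R S X Y U V O := by funext j; cases j <;> rfl
@[simp] theorem update_R : Function.update (conts A B R S X Y U V O) .R l =
    conts A B l S X Y U V O := by funext j; cases j <;> rfl
@[simp] theorem update_S : Function.update (conts A B R S X Y U V O) .S l =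
    conts A B R l X Y U V O := by funext j; cases j <;> rfl
@[simp] theorem update_X : Function.update (conts A B R S X Y U V O) .X l =
    conts A B R S l Y U V O := by funext j; cases j <;> rfl
@[simp] theorem update_Y : Function.update (conts A B R S X Y U V O) .Y l =
    conts A B R S X l U V O := by funext j; cases j <;> rfl
@[simp] theorem update_U : Function.update (conts A B R S X Y U V O) .U l =
    conts A B R S X Y l V O := by funext j; cases j <;> rfl
@[simp] theorem update_V : Function.update (conts A B R S X Y U V O) .V l =
    conts A B R S X Y U l O := by funext j; cases j <;> rfl
@[simp] theorem update_out : Function.update (conts A B R S X Y U V O) .out l =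
    conts A B R S X Y U V l := by funext j; cases j <;> rfl

end

attribute [simp] conts

/-- Stores a popped symbol. -/
def toCur (r : Reg) (o : Option Bool) : Reg := ⟨o, r.found, r.ok⟩

@[simp] theorem toCur_mk (o o' : Option Bool) (f k : Bool) : toCur ⟨o, f, k⟩ o' = ⟨o', f, k⟩ := rfl

/-- Pops the elements of the stack `j`, and pushes each of them on the stack `k`. -/
def pour (j k : Aux) : Program tm ι :=
  forEach (.pop j toCur) (.push k fun r => r.cur.getD false)

/-- Empties a stack. -/
def clear (j : Aux) : Program tm ι := forEach (.pop j toCur) (.load id)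

theorem foldl_cons_eq (l a : List Bool) : l.foldl (fun a b => b :: a) a = l.reverse ++ a := by
  induction l generalizing a with
  | nil => rfl
  | cons b l ih => simp [ih]

theorem does_pour {j k : Aux} (hjk : j ≠ k) (o : Option Bool) (f g : Bool) (i : List ι)
    (S S' : Aux → List Bool) (q : List (tm.Γ tm.k₀))
    (hS : S' = Function.update (Function.update S j []) k ((S j).reverse ++ S k)) :
    Does (pour j k) ((S j).length * 3 + 2) ⟨⟨o, f, g⟩, i, S, q⟩ ⟨⟨none, f, g⟩, i, S', q⟩ := by
  have h := does_forEach (tm := tm) (ι := ι) (next := .pop j toCur)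
    (body := .push k fun r => r.cur.getD false) (fun _ _ => True)
    (fun l a o => ⟨⟨o, f, g⟩, i, Function.update (Function.update S j l) k a, q⟩)
    (fun b l a => ⟨⟨some b, f, g⟩, i, Function.update (Function.update S j l) k a, q⟩)
    (fun a => ⟨⟨none, f, g⟩, i, Function.update (Function.update S j []) k a, q⟩)
    (fun a b => b :: a) 1
    (fun b l a o _ => (does_pop j toCur _).of
      (by simp [hjk, Function.update_comm hjk.symm]) le_rfl)
    (fun _ _ _ => rfl)
    (fun a o => (does_pop j toCur _).of
      (by simp [hjk, Function.update_comm hjk.symm]) le_rfl)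
    (fun _ => rfl)
    (fun b l a _ => ⟨trivial, some b, (does_push k _ _).of (by simp) le_rfl⟩) (S j) (S k) o trivial
  rw [foldl_cons_eq] at h
  subst hS
  simpa [pour] using h

theorem does_clear {j : Aux} (o : Option Bool) (f g : Bool) (i : List ι)
    (S S' : Aux → List Bool) (q : List (tm.Γ tm.k₀)) (hS : S' = Function.update S j []) :
    Does (clear j) ((S j).length * 3 + 2) ⟨⟨o, f, g⟩, i, S, q⟩ ⟨⟨none, f, g⟩, i, S', q⟩ := by
  have h := does_forEach (tm := tm) (ι := ι) (next := .pop j toCur)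
    (body := .load id) (fun _ _ => True)
    (fun l (_ : Unit) o => ⟨⟨o, f, g⟩, i, Function.update S j l, q⟩)
    (fun b l _ => ⟨⟨some b, f, g⟩, i, Function.update S j l, q⟩)
    (fun _ => ⟨⟨none, f, g⟩, i, Function.update S j [], q⟩)
    (fun a _ => a) 1
    (fun b l a o _ => (does_pop j toCur _).of (by simp) le_rfl)
    (fun _ _ _ => rfl)
    (fun a o => (does_pop j toCur _).of (by simp) le_rfl)
    (fun _ => rfl)
    (fun b l a _ => ⟨trivial, some b, does_load id _⟩) (S j) () o trivial
  subst hS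
  simpa [clear] using h

/-- Doubles the number of elements of the stack `A`, with `B` as auxiliary stack. -/
def double : Program tm ι :=
  .seq (forEach (.pop .A toCur) (.seq (.push .B fun _ => true) (.push .B fun _ => true)))
    (pour .B .A)

theorem foldl_twice (l a : List Bool) :
    l.foldl (fun a _ => true :: true :: a) a = List.replicate (2 * l.length) true ++ a := by
  induction l generalizing a with
  | nil => rfl
  | cons b l ih =>
    rw [List.foldl_cons, ih, List.length_cons, Nat.mul_succ, List.replicate_add]
    simp

theorem does_double (n : ℕ) (o : Option Bool) (f g : Bool) (i : List ι)
    (R S X Y U V O : List Bool) (q : List (tm.Γ tm.k₀)) :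
    Does double (n * 10 + 4)
      ⟨⟨o, f, g⟩, i, conts (List.replicate n true) [] R S X Y U V O, q⟩
      ⟨⟨none, f, g⟩, i, conts (List.replicate (2 * n) true) [] R S X Y U V O, q⟩ := by
  have h := does_forEach (tm := tm) (ι := ι) (next := .pop .A toCur)
    (body := .seq (.push .B fun _ => true) (.push .B fun _ => true)) (fun _ _ => True)
    (fun l a o => ⟨⟨o, f, g⟩, i, conts l a R S X Y U V O, q⟩)
    (fun b l a => ⟨⟨some b, f, g⟩, i, conts l a R S X Y U V O, q⟩)
    (fun a => ⟨⟨none, f, g⟩, i, conts [] a R S X Y U V O, q⟩)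
    (fun a _ => true :: true :: a) 2
    (fun b l a o _ => (does_pop _ _ _).of (by simp) le_rfl)
    (fun _ _ _ => rfl)
    (fun a o => (does_pop _ _ _).of (by simp) le_rfl)
    (fun _ => rfl)
    (fun b l a _ => ⟨trivial, some b, ((does_push _ _ _).seq (does_push _ _ _)).of (by simp) le_rfl⟩)
    (List.replicate n true) [] o trivial
  rw [foldl_twice] at h
  refine (h.seq (does_pour (by decide) _ _ _ _ _ _ _ ?_)).mono ?_
  · simp
  · simp
    omega

/-- Halves the number of elements of the stack `U`, with `V` as auxiliary stack. -/
def halve : Program tm ι :=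
  .seq (forEach (.pop .U toCur) (.ite Reg.found
    (.seq (.push .V fun _ => true) (.load fun r => ⟨r.cur, false, r.ok⟩))
    (.load fun r => ⟨r.cur, true, r.ok⟩)))
    (.seq (.load fun r => ⟨r.cur, false, r.ok⟩) (pour .V .U))

/-- The flag stores the parity of the elements seen so far, and every second element is kept; a flag
that is set at the start counts as one more element. -/
theorem foldl_half (l : List Bool) (m : ℕ) (f : Bool) :
    (l.foldl (fun (a : List Bool × Bool) _ => if a.2 then (true :: a.1, false) else (a.1, true))
      (List.replicate m true, f)).1 = List.replicate (m + (l.length + f.toNat) / 2) true := by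
  induction l generalizing m f with
  | nil => cases f <;> simp
  | cons b l ih =>
    cases f
    · simp [ih]
    · simp only [List.foldl_cons, if_true]
      rw [← List.replicate_succ, ih]
      simp only [Bool.toNat_false, List.length_cons, Bool.toNat_true]
      congr 1
      omega

theorem does_halve (n : ℕ) (o : Option Bool) (g : Bool) (i : List ι)
    (A B R S X Y O : List Bool) (q : List (tm.Γ tm.k₀)) :
    Does halve (n * 8 + 5)
      ⟨⟨o, false, g⟩, i, conts A B R S X Y (List.replicate n true) [] O, q⟩
      ⟨⟨none, false, g⟩, i, conts A B R S X Y (List.replicate (n / 2) true) [] O, q⟩ := by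
  have h := does_forEach (tm := tm) (ι := ι) (next := .pop .U toCur)
    (body := .ite Reg.found
      (.seq (.push .V fun _ => true) (.load fun r => ⟨r.cur, false, r.ok⟩))
      (.load fun r => ⟨r.cur, true, r.ok⟩)) (fun _ _ => True)
    (fun l a o => ⟨⟨o, a.2, g⟩, i, conts A B R S X Y l a.1 O, q⟩)
    (fun b l a => ⟨⟨some b, a.2, g⟩, i, conts A B R S X Y l a.1 O, q⟩)
    (fun a => ⟨⟨none, a.2, g⟩, i, conts A B R S X Y [] a.1 O, q⟩)
    (fun a _ => if a.2 then (true :: a.1, false) else (a.1, true)) 3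
    (fun b l a o _ => (does_pop _ _ _).of (by simp) le_rfl)
    (fun _ _ _ => rfl)
    (fun a o => (does_pop _ _ _).of (by simp) le_rfl)
    (fun _ => rfl)
    (fun b l a _ => by
      refine ⟨trivial, some b, ?_⟩
      obtain ⟨v, _ | _⟩ := a
      · exact (Does.ite_false rfl (does_load _ _)).of (by simp) (by omega)
      · exact (Does.ite_true rfl ((does_push _ _ _).seq (does_load _ _))).of (by simp) le_rfl)
    (List.replicate n true) (List.replicate 0 true, false) o trivial
  have hf := foldl_half (List.replicate n true) 0 false
  simp at hf
  refine (h.seq ((does_load _ _).seq (does_pour (by decide) _ _ _ _ _ _ _ ?_))).mono ?_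
  · simp [hf]
  · simp [hf]
    omega

theorem does_rep_double (c n : ℕ) (f g : Bool) (i : List ι)
    (R S X Y U V O : List Bool) (q : List (tm.Γ tm.k₀)) :
    Does (rep double c) (c * (2 ^ c * n * 10 + 4) + 1)
      ⟨⟨none, f, g⟩, i, conts (List.replicate n true) [] R S X Y U V O, q⟩
      ⟨⟨none, f, g⟩, i, conts (List.replicate (2 ^ c * n) true) [] R S X Y U V O, q⟩ := by
  have h := does_rep (tm := tm) (ι := ι) (p := double)
    (fun j => ⟨⟨none, f, g⟩, i, conts (List.replicate (2 ^ j * n) true) [] R S X Y U V O, q⟩)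
    (2 ^ c * n * 10 + 4) c fun j hj => ((does_double _ _ _ _ _ _ _ _ _ _ _ _ _).of
      -- Every pass is charged the cost of the largest one.
      (by simp [pow_succ']; ring_nf) (by gcongr; norm_num))
  simpa using h

theorem does_rep_halve (c n : ℕ) (g : Bool) (i : List ι)
    (A B R S X Y O : List Bool) (q : List (tm.Γ tm.k₀)) :
    Does (rep halve c) (c * (n * 8 + 5) + 1)
      ⟨⟨none, false, g⟩, i, conts A B R S X Y (List.replicate n true) [] O, q⟩
      ⟨⟨none, false, g⟩, i, conts A B R S X Y (List.replicate (n / 2 ^ c) true) [] O, q⟩ := by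
  have h := does_rep (tm := tm) (ι := ι) (p := halve)
    (fun j => ⟨⟨none, false, g⟩, i,
      conts A B R S X Y (List.replicate (n / 2 ^ j) true) [] O, q⟩)
    (n * 8 + 5) c fun j hj => ((does_halve _ _ _ _ _ _ _ _ _ _ _ _).of
      (by rw [Nat.div_div_eq_div_mul, ← pow_succ]) (by gcongr; exact Nat.div_le_self _ _))
  simpa using h

/-- Moves as many symbols from `R` to `S` as `A` has elements, and prepares them for the
subroutine. -/
def loadBlock (φ : Bool → tm.Γ tm.k₀) : Program tm ι :=
  .seq (forEach (.pop .A toCur) (.seq (.push .B fun _ => true) (.seq (.pop .R toCur)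
    (.seq (.push .S fun r => r.cur.getD false) (.feed fun r => φ (r.cur.getD false))))))
    (pour .B .A)

/-- The stack `A` holds the block length in unary and is restored through `B`. Moving a block
reverses it; the blocks on `R` will already be reversed, so the subroutine sees them in the right
order. -/
theorem does_loadBlock (φ : Bool → tm.Γ tm.k₀) (c : List Bool) (o : Option Bool) (f g : Bool)
    (i : List ι) (R S X Y U V O : List Bool) (q : List (tm.Γ tm.k₀)) :
    Does (loadBlock φ) (c.length * 9 + 4)
      ⟨⟨o, f, g⟩, i, conts (List.replicate c.length true) [] (c ++ R) S X Y U V O, q⟩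
      ⟨⟨none, f, g⟩, i, conts (List.replicate c.length true) [] R (c.reverse ++ S) X Y U V O,
        c.reverse.map φ ++ q⟩ := by
  -- The default `false` is never used, since `A` has exactly as many elements as the block.
  let step (a : List Bool × List Bool × List Bool × List (tm.Γ tm.k₀)) (_ : Bool) :=
    (true :: a.1, a.2.1.tail, a.2.1.head?.getD false :: a.2.2.1,
      φ (a.2.1.head?.getD false) :: a.2.2.2)
  have hf : ∀ (c B S : List Bool) (q : List (tm.Γ tm.k₀)),
      (List.replicate c.length true).foldl step (B, c ++ R, S, q) =
        (List.replicate c.length true ++ B, R, c.reverse ++ S, c.reverse.map φ ++ q) := by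
    intro c
    induction c with
    | nil => intros; rfl
    | cons b c ih =>
      intro B S q
      rw [List.length_cons, List.replicate_succ, List.foldl_cons]
      simp only [step, List.cons_append, List.tail_cons, List.head?_cons, Option.getD_some]
      rw [ih, List.append_cons, ← List.replicate_succ', List.replicate_succ]
      simp
  have h := does_forEach (tm := tm) (ι := ι) (next := .pop .A toCur)
    (body := .seq (.push .B fun _ => true) (.seq (.pop .R toCur)
      (.seq (.push .S fun r => r.cur.getD false) (.feed fun r => φ (r.cur.getD false)))))
    (fun _ _ => True)
    (fun l a o => ⟨⟨o, f, g⟩, i, conts l a.1 a.2.1 a.2.2.1 X Y U V O, a.2.2.2⟩)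
    (fun b l a => ⟨⟨some b, f, g⟩, i, conts l a.1 a.2.1 a.2.2.1 X Y U V O, a.2.2.2⟩)
    (fun a => ⟨⟨none, f, g⟩, i, conts [] a.1 a.2.1 a.2.2.1 X Y U V O, a.2.2.2⟩)
    step 4
    (fun b l a o _ => (does_pop _ _ _).of (by simp) le_rfl)
    (fun _ _ _ => rfl)
    (fun a o => (does_pop _ _ _).of (by simp) le_rfl)
    (fun _ => rfl)
    (fun b l a _ => ⟨trivial, _, ((does_push _ _ _).seq ((does_pop _ _ _).seq
      ((does_push _ _ _).seq (does_feed _ _)))).of (by simp [step]; rfl) le_rfl⟩)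
    (List.replicate c.length true) ([], c ++ R, S, q) o trivial
  rw [hf] at h
  refine (h.seq (does_pour (by decide) _ _ _ _ _ _ _ ?_)).mono ?_
  · simp
  · simp
    omega

end

end Machine

end NaturalSeeds

namespace NaturalSeeds

open Turing

namespace Machine

/-! ### Searching the second string of a pair for a good block -/

section

variable {tm : FinTM2}

/-- Runs the subroutine on a block of the string on the stack `R`. -/
def testBlock (φ : Bool → tm.Γ tm.k₀) (ψ : tm.Γ tm.k₁ → Bool) : Program tm (Option Bool) :=
  .seq (loadBlock φ) (.call fun r o => ⟨r.cur, r.found || o.any ψ, r.ok⟩)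

/-- Given a pair `(x, y)`, splits `y` into blocks of length `2 ^ |x|`, runs the subroutine on each
of them, and writes `1` if `x` is empty or a block is accepted. -/
def searchProg (φ : Bool → tm.Γ tm.k₀) (ψ : tm.Γ tm.k₁ → Bool) : Program tm (Option Bool) :=
  .seq (.push .A fun _ => true) <|
  .seq (.load fun r => ⟨r.cur, true, r.ok⟩) <|
  .seq (forEach (.read fun r o => ⟨o.join, r.found, r.ok⟩)
    (.seq (.load fun r => ⟨r.cur, false, r.ok⟩) double)) <|
  .seq (forEach (.read fun r o => ⟨o.join, r.found, r.ok⟩)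
    (.push .R fun r => r.cur.getD false)) <|
  .seq (forEach (.peek .R toCur) (testBlock φ ψ)) <|
  .seq (clear .A) <|
  .seq (clear .S) <|
  .seq (.ite Reg.found (.push .out fun _ => true) (.load id)) <|
  .load fun _ => Reg.init

/-- A bound on the running time of `searchProg`, where `n` and `N` are the lengths of the strings,
`k` is the number of blocks, and `t` is a bound on the running time of the subroutine. -/
def searchTime (n N k t : ℕ) : ℕ :=
  n * (2 ^ n * 10 + 7) + N * 6 + k * (2 ^ n * 9 + t + 7) + 2 ^ n * 3 + 20

theorem does_searchProg (φ : Bool → tm.Γ tm.k₀) (ψ : tm.Γ tm.k₁ → Bool) (good : List Bool → Bool)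
    (x : List Bool) (bs : List (List Bool)) (t : ℕ) (hlen : ∀ b ∈ bs, b.length = 2 ^ x.length)
    (hrun : ∀ b ∈ bs, ∃ o, ψ o = good b ∧ Nonempty (TM2OutputsInTime tm (b.map φ) (some [o]) t)) :
    Does (searchProg φ ψ) (searchTime x.length bs.flatten.length bs.length t)
      ⟨Reg.init, encodePair x bs.flatten, fun _ => [], []⟩
      ⟨Reg.init, [], Function.update (fun _ => []) .out
        (if x = [] ∨ ∃ b ∈ bs, good b = true then [true] else []), []⟩ := by
  have e0 : (fun _ => [] : Aux → List Bool) = conts [] [] [] [] [] [] [] [] [] := by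
    funext j; cases j <;> rfl
  -- Reading `x` builds `2 ^ |x|` in unary on `A`. `Option.join` identifies the separator with the
  -- end of the input, so the loop stops at the separator. The flag `m == 0` records whether `x` is
  -- empty.
  have h1 := does_forEach (tm := tm) (ι := Option Bool)
    (next := .read fun r o => ⟨o.join, r.found, r.ok⟩)
    (body := .seq (.load fun r => ⟨r.cur, false, r.ok⟩) double)
    (fun l m => m + l.length = x.length)
    (fun l m o => ⟨⟨o, m == 0, false⟩, encodePair l bs.flatten,
      conts (List.replicate (2 ^ m) true) [] [] [] [] [] [] [] [], []⟩)
    (fun b l m => ⟨⟨some b, m == 0, false⟩, encodePair l bs.flatten,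
      conts (List.replicate (2 ^ m) true) [] [] [] [] [] [] [] [], []⟩)
    (fun m => ⟨⟨none, m == 0, false⟩, bs.flatten.map some,
      conts (List.replicate (2 ^ m) true) [] [] [] [] [] [] [] [], []⟩)
    (fun m _ => m + 1) (2 ^ x.length * 10 + 5)
    (fun b l m o _ => (does_read _ _).of (by simp [encodePair]) le_rfl)
    (fun _ _ _ => rfl)
    (fun m o => (does_read _ _).of (by simp [encodePair]) le_rfl)
    (fun _ => rfl)
    (fun b l m h => ⟨by simp at h ⊢; omega, none,
      ((does_load _ _).seq (does_double _ _ _ _ _ _ _ _ _ _ _ _ _)).of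
        (by simp [pow_succ']) (by
          have : 2 ^ m ≤ 2 ^ x.length := Nat.pow_le_pow_right (by norm_num) (by simp at h; omega)
          omega)⟩)
    x 0 none (by simp)
  have e1 : x.foldl (fun m _ => m + 1) 0 = x.length := by
    simp [List.foldl_add_const]
  rw [e1] at h1
  have h2 := does_forEach (tm := tm) (ι := Option Bool)
    (next := .read fun r o => ⟨o.join, r.found, r.ok⟩)
    (body := .push .R fun r => r.cur.getD false)
    (fun _ _ => True)
    (fun l R o => ⟨⟨o, x.length == 0, false⟩, l.map some,
      conts (List.replicate (2 ^ x.length) true) [] R [] [] [] [] [] [], []⟩)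
    (fun b l R => ⟨⟨some b, x.length == 0, false⟩, l.map some,
      conts (List.replicate (2 ^ x.length) true) [] R [] [] [] [] [] [], []⟩)
    (fun R => ⟨⟨none, x.length == 0, false⟩, [],
      conts (List.replicate (2 ^ x.length) true) [] R [] [] [] [] [] [], []⟩)
    (fun R b => b :: R) 1
    (fun b l R o _ => (does_read _ _).of (by simp) le_rfl)
    (fun _ _ _ => rfl)
    (fun m o => (does_read _ _).of (by simp) le_rfl)
    (fun _ => rfl)
    (fun b l m h => ⟨trivial, some b, (does_push _ _ _).of (by simp) le_rfl⟩)
    bs.flatten [] none trivial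
  rw [foldl_cons_eq, List.append_nil, List.reverse_flatten] at h2
  -- The stack `R` contains `y` reversed, that is, the reversed blocks in reverse order; loading
  -- turns each of them round again.
  have h3 := does_forEach (tm := tm) (ι := Option Bool)
    (next := .peek .R toCur) (body := testBlock φ ψ)
    (fun l _ => ∀ c ∈ l, c.reverse ∈ bs)
    (fun l a o => ⟨⟨o, a.1, false⟩, [],
      conts (List.replicate (2 ^ x.length) true) [] l.flatten a.2 [] [] [] [] [], []⟩)
    (fun c l a => ⟨⟨some (c.head?.getD false), a.1, false⟩, [],
      conts (List.replicate (2 ^ x.length) true) [] (c ++ l.flatten) a.2 [] [] [] [] [], []⟩)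
    (fun a => ⟨⟨none, a.1, false⟩, [],
      conts (List.replicate (2 ^ x.length) true) [] [] a.2 [] [] [] [] [], []⟩)
    (fun (a : Bool × List Bool) c => (a.1 || good c.reverse, c.reverse ++ a.2))
    (2 ^ x.length * 9 + t + 5)
    -- Blocks have positive length, so peeking at `R` finds it empty only when no block is left.
    (fun c l a o h => by
      have hc := hlen _ (h c (by simp))
      obtain _ | ⟨b, c⟩ := c
      · exact absurd hc.symm (by simp)
      · exact (does_peek _ _ _).of (by simp) le_rfl)
    (fun _ _ _ => rfl)
    (fun m o => (does_peek _ _ _).of (by simp) le_rfl)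
    (fun _ => rfl)
    (fun c l a h => by
      have hc := hlen _ (h c (by simp))
      rw [List.length_reverse] at hc
      obtain ⟨o, ho, hrun⟩ := hrun _ (h c (by simp))
      refine ⟨fun c hc => h c (by simp [hc]), none, ?_⟩
      have h4 := does_loadBlock (tm := tm) (ι := Option Bool) φ c (some (c.head?.getD false))
        a.1 false [] l.flatten a.2 [] [] [] [] [] []
      rw [hc, List.append_nil] at h4
      exact (h4.seq (does_call _ _ (some o) t hrun)).of (by simp [ho]) (by omega))
    (bs.map List.reverse).reverse (x.length == 0, []) none (by simp)
  have e2 : ∀ (l : List (List Bool)) (a : Bool × List Bool),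
      (l.foldl (fun (a : Bool × List Bool) c => (a.1 || good c.reverse, c.reverse ++ a.2)) a) =
        (a.1 || l.any fun c => good c.reverse, l.flatten.reverse ++ a.2) := by
    intro l
    induction l with
    | nil => simp
    | cons b l ih => intro a; simp [ih, Bool.or_assoc]
  rw [e2] at h3
  have e3 : ((x.length == 0) || (bs.map List.reverse).reverse.any fun c => good c.reverse) =
      decide (x = [] ∨ ∃ b ∈ bs, good b = true) := by
    rw [Bool.eq_iff_iff]
    simp
  simp only [e3] at h3
  have ha : Does (tm := tm) (ι := Option Bool) (.push .A fun _ => true) 1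
      ⟨Reg.init, encodePair x bs.flatten, fun _ => [], []⟩
      ⟨Reg.init, encodePair x bs.flatten,
        conts (List.replicate (2 ^ 0) true) [] [] [] [] [] [] [] [], []⟩ :=
    (does_push _ _ _).of (by simp [e0]) le_rfl
  have hb := does_load (tm := tm) (ι := Option Bool) (fun r => ⟨r.cur, true, r.ok⟩)
      ⟨Reg.init, encodePair x bs.flatten,
        conts (List.replicate (2 ^ 0) true) [] [] [] [] [] [] [] [], []⟩
  set S := (bs.map List.reverse).reverse.flatten.reverse with hS
  have hSl : S.length = bs.flatten.length := by
    rw [hS, ← List.reverse_flatten, List.reverse_reverse]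
  rw [List.append_nil] at h3
  have hc := does_clear (tm := tm) (j := .A) none (decide (x = [] ∨ ∃ b ∈ bs, good b = true))
    false ([] : List (Option Bool))
    (conts (List.replicate (2 ^ x.length) true) [] [] S [] [] [] [] [])
    (conts [] [] [] S [] [] [] [] []) [] (by simp)
  have hd := does_clear (tm := tm) (j := .S) none (decide (x = [] ∨ ∃ b ∈ bs, good b = true))
    false ([] : List (Option Bool)) (conts [] [] [] S [] [] [] [] [])
    (conts [] [] [] [] [] [] [] [] []) [] (by simp)
  have he : Does (tm := tm) (ι := Option Bool)
      (.ite Reg.found (.push .out fun _ => true) (.load id)) 2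
      ⟨⟨none, decide (x = [] ∨ ∃ b ∈ bs, good b = true), false⟩, [],
        conts [] [] [] [] [] [] [] [] [], []⟩
      ⟨⟨none, decide (x = [] ∨ ∃ b ∈ bs, good b = true), false⟩, [], conts [] [] [] [] [] [] [] []
        (if x = [] ∨ ∃ b ∈ bs, good b = true then [true] else []), []⟩ := by
    by_cases h : x = [] ∨ ∃ b ∈ bs, good b = true
    · exact (Does.ite_true (by simp [h]) (does_push _ _ _)).of (by simp [h]) le_rfl
    · exact (Does.ite_false (by simp [h]) (does_load _ _)).of (by simp [h]) le_rfl
  refine (ha.seq <| hb.seq <| h1.seq <| h2.seq <| h3.seq <| hc.seq <| hd.seq <|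
    he.seq <| does_load _ _).of (by simp [e0]) ?_
  simp only [conts, hSl, searchTime, List.length_replicate, List.length_reverse, List.length_map]
  ring_nf
  omega

theorem exists_search (T : TM2ComputableAux Bool Bool) (good : List Bool → Bool) :
    ∃ T' : TM2ComputableAux (Option Bool) Bool, ∀ (x : List Bool) (bs : List (List Bool)) (t : ℕ),
      (∀ b ∈ bs, b.length = 2 ^ x.length) →
      (∀ b ∈ bs, Nonempty (TM2OutputsInTime T.tm (b.map T.inputAlphabet.symm)
        (some ([good b].map T.outputAlphabet.symm)) t)) →
      ∀ t', searchTime x.length bs.flatten.length bs.length t + 1 ≤ t' →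
        Nonempty (TM2OutputsInTime T'.tm ((encodePair x bs.flatten).map T'.inputAlphabet.symm)
          (some ((if x = [] ∨ ∃ b ∈ bs, good b = true then [true] else []).map
            T'.outputAlphabet.symm)) t') := by
  refine ⟨computer (searchProg (tm := T.tm) T.inputAlphabet.symm T.outputAlphabet), ?_⟩
  intro x bs t hlen hrun t' ht
  exact computer_outputs (does_searchProg _ _ good x bs t hlen fun b hb =>
    ⟨T.outputAlphabet.symm (good b), by simp, hrun b hb⟩) ht

end

end Machine

end NaturalSeeds

namespace NaturalSeeds

open Turing

namespace Machine

/-! ### Binary counters -/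

/-- The binary representation of `i` with `n` digits, the least significant digit first. -/
def bits : ℕ → ℕ → List Bool
  | 0, _ => []
  | n + 1, i => decide (i % 2 = 1) :: bits n (i / 2)

theorem length_bits (n i : ℕ) : (bits n i).length = n := by
  induction n generalizing i with
  | zero => rfl
  | succ n ih => simp [bits, ih]

theorem bits_zero (n : ℕ) : bits n 0 = List.replicate n false := by
  induction n with
  | zero => rfl
  | succ n ih => simp [bits, ih, List.replicate_succ]

theorem bits_last (n i : ℕ) (h : i + 1 = 2 ^ n) : bits n i = List.replicate n true := by
  induction n generalizing i with
  | zero => rfl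
  | succ n ih =>
    rw [pow_succ] at h
    rw [bits, ih (i / 2) (by omega), List.replicate_succ]
    simp
    omega

theorem bits_succ (n i : ℕ) (h : i + 1 < 2 ^ n) :
    ∃ k l, bits n i = List.replicate k true ++ false :: l ∧
      bits n (i + 1) = List.replicate k false ++ true :: l := by
  induction n generalizing i with
  | zero => simp at h
  | succ n ih =>
    rw [pow_succ] at h
    rcases Nat.mod_two_eq_zero_or_one i with hi | hi
    · refine ⟨0, bits n (i / 2), ?_, ?_⟩
      · simp [bits, hi]
      · have h1 : (i + 1) % 2 = 1 := by omega
        have h2 : (i + 1) / 2 = i / 2 := by omega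
        simp [bits, h1, h2]
    · obtain ⟨k, l, h1, h2⟩ := ih (i / 2) (by omega)
      refine ⟨k + 1, l, ?_, ?_⟩
      · simp [bits, hi, h1, List.replicate_succ]
      · have h3 : (i + 1) % 2 = 0 := by omega
        have h4 : (i + 1) / 2 = i / 2 + 1 := by omega
        simp [bits, h3, h4, h2, List.replicate_succ]

theorem exists_bits (x : List Bool) : ∃ i < 2 ^ x.length, bits x.length i = x := by
  induction x with
  | nil => exact ⟨0, by simp, rfl⟩
  | cons b x ih =>
    obtain ⟨i, hi, h⟩ := ih
    have h1 : (2 * i + b.toNat) / 2 = i := by cases b <;> simp; omega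
    have h2 : decide ((2 * i + b.toNat) % 2 = 1) = b := by cases b <;> simp
    refine ⟨2 * i + b.toNat, ?_, ?_⟩
    · have := b.toNat_lt
      rw [List.length_cons, pow_succ]
      omega
    · rw [List.length_cons, bits, h1, h2, h]

section

variable {tm : FinTM2} {ι : Type}

/-- Adds one to the binary number on the stack `X`. In the case of an overflow, `X` is empty
afterwards. -/
def increment : Program tm ι :=
  .seq (.pop .X toCur) <|
  .seq (.loop (fun r => r.cur == some true) (.seq (.push .Y fun _ => false) (.pop .X toCur))) <|
  .ite (fun r => r.cur.isSome)
    (.seq (.push .X fun _ => true) (.seq (pour .Y .X) (.load fun r => ⟨some true, r.found, r.ok⟩)))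
    (.load id)

/-- The loop always holds the top digit in the register, which is why the states mention `head?` and
`tail`. The trailing ones become zeros on `Y`, until a zero or the end of the number. -/
theorem does_carry (k j : ℕ) (f g : Bool) (i : List ι) (A B R S X U V O : List Bool)
    (q : List (tm.Γ tm.k₀)) (hX : X.head? ≠ some true) :
    Does (.loop (fun r => r.cur == some true) (.seq (.push .Y fun _ => false) (.pop .X toCur)))
      (k * 3 + 1)
      ⟨⟨(List.replicate k true ++ X).head?, f, g⟩, i,
        conts A B R S (List.replicate k true ++ X).tail (List.replicate j false) U V O, q⟩
      ⟨⟨X.head?, f, g⟩, i, conts A B R S X.tail (List.replicate (k + j) false) U V O, q⟩ := by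
  induction k generalizing j with
  | zero =>
    simp only [Nat.zero_add, Nat.zero_mul, List.replicate_zero, List.nil_append]
    refine does_loop_false (b := fun r => r.cur == some true) ?_
    simpa using hX
  | succ k ih =>
    have h := (does_push (tm := tm) .Y (fun _ => false) ⟨⟨some true, f, g⟩, i,
      conts A B R S (List.replicate k true ++ X) (List.replicate j false) U V O, q⟩).seq
      (does_pop .X toCur _)
    exact (Does.loop_true (b := fun r => r.cur == some true) rfl (h.of (by simp [← List.replicate_succ]) le_rfl)
      (ih (j + 1))).of (by simp only [Nat.succ_add, Nat.add_succ]) (by omega)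

/-- On overflow the register holds `none`, which is the signal for the calling loop to stop; the
zeros left on `Y` are removed by the caller. -/
theorem does_increment (n a : ℕ) (ha : a < 2 ^ n) (o : Option Bool) (f g : Bool) (i : List ι)
    (A B R S U V O : List Bool) (q : List (tm.Γ tm.k₀)) :
    Does increment (n * 6 + 8)
      ⟨⟨o, f, g⟩, i, conts A B R S (bits n a) [] U V O, q⟩
      ⟨⟨if a + 1 < 2 ^ n then some true else none, f, g⟩, i,
        conts A B R S (if a + 1 < 2 ^ n then bits n (a + 1) else [])
          (if a + 1 < 2 ^ n then [] else List.replicate n false) U V O, q⟩ := by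
  by_cases h : a + 1 < 2 ^ n
  · obtain ⟨k, l, h1, h2⟩ := bits_succ n a h
    have hk : k + 1 + l.length = n := by
      rw [← length_bits n a, h1]
      simp
      omega
    simp only [h, if_true]
    rw [h1, h2]
    have h3 := does_carry (tm := tm) k 0 f g i A B R S (false :: l) U V O q (by simp)
    have h4 := (does_push (tm := tm) .X (fun _ => true) ⟨⟨some false, f, g⟩, i,
      conts A B R S l (List.replicate (k + 0) false) U V O, q⟩).seq
      ((does_pour (j := .Y) (k := .X) (by decide) _ _ _ _ _ _ _ rfl).seq
        (does_load (fun r => ⟨some true, r.found, r.ok⟩) _))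
    have h5 : Does (tm := tm) (ι := ι) (.pop .X toCur) 1
        ⟨⟨o, f, g⟩, i, conts A B R S (List.replicate k true ++ false :: l) [] U V O, q⟩
        ⟨⟨(List.replicate k true ++ false :: l).head?, f, g⟩, i, conts A B R S
          (List.replicate k true ++ false :: l).tail (List.replicate 0 false) U V O, q⟩ :=
      (does_pop _ _ _).of (by simp) le_rfl
    refine (h5.seq (h3.seq
      (Does.ite_true (b := fun r => r.cur.isSome) (q := .load id) rfl h4))).of ?_ ?_
    · simp
    · simp
      omega
  · have h1 := bits_last n a (by omega)
    simp only [h, if_false]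
    rw [h1]
    have h3 := does_carry (tm := tm) n 0 f g i A B R S [] U V O q (by simp)
    rw [List.append_nil] at h3
    have h5 : Does (tm := tm) (ι := ι) (.pop .X toCur) 1
        ⟨⟨o, f, g⟩, i, conts A B R S (List.replicate n true) [] U V O, q⟩
        ⟨⟨(List.replicate n true).head?, f, g⟩, i, conts A B R S
          (List.replicate n true).tail (List.replicate 0 false) U V O, q⟩ :=
      (does_pop _ _ _).of (by simp) le_rfl
    refine (h5.seq (h3.seq
      (Does.ite_false (b := fun r => r.cur.isSome) rfl (does_load id _)))).of ?_ ?_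
    · simp
    · omega

end

end Machine

end NaturalSeeds

namespace NaturalSeeds

open Turing

namespace Machine

/-! ### Testing all strings against the blocks of a truth table -/

section

variable {tm : FinTM2}

/-- From a string of length `2 ^ N`, computes the unary representations of `N / (c + 1)` and
`2 ^ (c * (N / (c + 1)))`. -/
def sizesProg (c : ℕ) : Program tm Bool :=
  .seq (.push .A fun _ => true) <|
  .seq (rep halve (c + 1)) <|
  .seq (.peek .U toCur) <|
  .loop (fun r => r.cur.isSome) <|
    .seq (.push .X fun _ => false) <|
    .seq (.load fun r => ⟨none, r.found, r.ok⟩) <|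
    .seq (rep double c) <|
    .seq (rep halve (c + 1)) <|
    .peek .U toCur

/-- A bound on the running time of a pass of `sizesProg`. -/
def sizesTime (c L : ℕ) : ℕ := c * (L * 10 + 4) + (c + 1) * (L * 8 + 5) + 5

theorem div_pow_pos_iff (c N i : ℕ) :
    0 < 2 ^ N / 2 ^ ((c + 1) * (i + 1)) ↔ i < N / (c + 1) := by
  rw [Nat.div_pos_iff, Nat.pow_le_pow_iff_right (by norm_num), ← Nat.add_one_le_iff (n := i),
    Nat.le_div_iff_mul_le (by omega), Nat.mul_comm]
  simp

/-- The exponent `N` is never computed. Dividing the unary `2 ^ N` by `2 ^ (c + 1)` until nothing is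
left takes `N / (c + 1)` counted passes, and each pass multiplies `A` by `2 ^ c`. -/
theorem does_sizesProg (c N : ℕ) (R : List Bool) :
    Does (sizesProg c) ((2 ^ N + 2) * (sizesTime c (2 ^ N) + 1))
      ⟨⟨none, false, false⟩, [], conts [] [] R [] [] [] (List.replicate (2 ^ N) true) [] [],
        ([] : List (tm.Γ tm.k₀))⟩
      ⟨⟨none, false, false⟩, [], conts (List.replicate (2 ^ (c * (N / (c + 1)))) true) [] R []
        (List.replicate (N / (c + 1)) false) [] [] [] [], []⟩ := by
  have h1 : Does (tm := tm) (ι := Bool) (.push .A fun _ => true) 1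
      ⟨⟨none, false, false⟩, [], conts [] [] R [] [] [] (List.replicate (2 ^ N) true) [] [], []⟩
      ⟨⟨none, false, false⟩, [], conts [true] [] R [] [] [] (List.replicate (2 ^ N) true) [] [],
        []⟩ :=
    (does_push _ _ _).of (by simp) le_rfl
  have h2 := does_rep_halve (tm := tm) (ι := Bool) (c + 1) (2 ^ N) false [] [true] [] R [] [] [] []
    []
  -- The divisions on `U` are one round ahead of the count on `X`, so that an empty `U` means that
  -- no further pass is due.
  let st (i : ℕ) : State tm Bool := ⟨⟨(List.replicate (2 ^ N / 2 ^ ((c + 1) * (i + 1))) true).head?,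
    false, false⟩, [], conts (List.replicate (2 ^ (c * i)) true) [] R []
      (List.replicate i false) [] (List.replicate (2 ^ N / 2 ^ ((c + 1) * (i + 1))) true) [] [], []⟩
  have h3 : Does (tm := tm) (ι := Bool) (.peek .U toCur) 1
      ⟨⟨none, false, false⟩, [], conts [true] [] R [] [] []
        (List.replicate (2 ^ N / 2 ^ (c + 1)) true) [] [], []⟩ (st 0) :=
    (does_peek _ _ _).of (by simp [st]) le_rfl
  have hle : ∀ i ≤ N / (c + 1), 2 ^ (c * i) ≤ 2 ^ N := by
    intro i hi
    apply Nat.pow_le_pow_right (by norm_num)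
    have := (Nat.le_div_iff_mul_le (by omega)).1 hi
    nlinarith
  have h4 := does_loop_iterate (tm := tm) (ι := Bool) (b := fun r => r.cur.isSome)
    (p := .seq (.push .X fun _ => false) <|
      .seq (.load fun r => ⟨none, r.found, r.ok⟩) <| .seq (rep double c) <|
      .seq (rep halve (c + 1)) <| .peek .U toCur) st (sizesTime c (2 ^ N)) (N / (c + 1))
    (by
      intro i hi
      have hpos := (div_pow_pos_iff c N i).2 hi
      refine ⟨?_, ?_⟩
      · simp [st, List.head?_replicate, hpos.ne']
      · obtain ⟨u, hu⟩ : ∃ u, 2 ^ N / 2 ^ ((c + 1) * (i + 1)) = u + 1 :=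
          ⟨_, (Nat.sub_add_cancel hpos).symm⟩
        have g1 : Does (tm := tm) (ι := Bool) (.push .X fun _ => false) 1 (st i)
            ⟨⟨some true, false, false⟩, [], conts (List.replicate (2 ^ (c * i)) true) [] R []
              (List.replicate (i + 1) false) []
              (List.replicate (2 ^ N / 2 ^ ((c + 1) * (i + 1))) true) [] [], []⟩ :=
          (does_push _ _ _).of (by simp [st, hu, List.replicate_succ]) le_rfl
        have g2 := does_rep_double (tm := tm) (ι := Bool) c (2 ^ (c * i)) false false [] R []
          (List.replicate (i + 1) false) []
          (List.replicate (2 ^ N / 2 ^ ((c + 1) * (i + 1))) true) [] [] []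
        have g3 := does_rep_halve (tm := tm) (ι := Bool) (c + 1)
          (2 ^ N / 2 ^ ((c + 1) * (i + 1))) false [] (List.replicate (2 ^ c * 2 ^ (c * i)) true) []
          R [] (List.replicate (i + 1) false) [] [] []
        have e1 : 2 ^ c * 2 ^ (c * i) = 2 ^ (c * (i + 1)) := by ring
        have e2 : 2 ^ N / 2 ^ ((c + 1) * (i + 1)) / 2 ^ (c + 1) =
            2 ^ N / 2 ^ ((c + 1) * (i + 1 + 1)) := by
          rw [Nat.div_div_eq_div_mul, ← pow_add]
          congr 2
        refine (g1.seq <| (does_load _ _).seq <| g2.seq <| g3.seq <| does_peek _ _ _).of ?_ ?_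
        · simp only [conts, toCur_mk, e1, e2, st]
        · have h5 := hle (i + 1) hi
          have h6 : 2 ^ N / 2 ^ ((c + 1) * (i + 1)) ≤ 2 ^ N := Nat.div_le_self _ _
          rw [e1]
          have h7 := Nat.mul_le_mul_left c (show 2 ^ (c * (i + 1)) * 10 + 4 ≤ 2 ^ N * 10 + 4 by omega)
          have h8 := Nat.mul_le_mul_left (c + 1) (show 2 ^ N / 2 ^ ((c + 1) * (i + 1)) * 8 + 5 ≤
            2 ^ N * 8 + 5 by omega)
          simp only [sizesTime]
          omega)
    (by
      have h : ¬ 0 < 2 ^ N / 2 ^ ((c + 1) * (N / (c + 1) + 1)) := by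
        rw [div_pow_pos_iff]; omega
      simp only [st, Nat.eq_zero_of_not_pos h]
      rfl)
  refine (h1.seq <| h2.seq <| h3.seq h4).of ?_ ?_
  · have h : ¬ 0 < 2 ^ N / 2 ^ ((c + 1) * (N / (c + 1) + 1)) := by
      rw [div_pow_pos_iff]; omega
    simp only [st, Nat.eq_zero_of_not_pos h]
    rfl
  · have h5 : N / (c + 1) ≤ 2 ^ N := (Nat.div_le_self _ _).trans N.lt_two_pow_self.le
    have h6 : (c + 1) * (2 ^ N * 8 + 5) + 5 ≤ sizesTime c (2 ^ N) := by
      simp only [sizesTime]; omega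
    calc _ = 1 + ((c + 1) * (2 ^ N * 8 + 5) + 1 + (1 +
          (N / (c + 1) * (sizesTime c (2 ^ N) + 1) + 1))) := rfl
      _ ≤ sizesTime c (2 ^ N) + 2 ^ N * (sizesTime c (2 ^ N) + 1) := by
        have := Nat.mul_le_mul_right (sizesTime c (2 ^ N) + 1) h5
        omega
      _ ≤ _ := by ring_nf; omega

/-- Copies the string on the stack `X` to the input of the subroutine. -/
def loadString (φ : Option Bool → tm.Γ tm.k₀) : Program tm Bool :=
  .seq (forEach (.pop .X toCur) (.seq (.push .Y fun r => r.cur.getD false)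
    (.feed fun r => φ (some (r.cur.getD false))))) (pour .Y .X)

theorem does_loadString (φ : Option Bool → tm.Γ tm.k₀) (o : Option Bool) (f g : Bool)
    (A B R S X U V O : List Bool) (q : List (tm.Γ tm.k₀)) :
    Does (loadString φ) (X.length * 7 + 4)
      ⟨⟨o, f, g⟩, [], conts A B R S X [] U V O, q⟩
      ⟨⟨none, f, g⟩, [], conts A B R S X [] U V O, (X.reverse.map some).map φ ++ q⟩ := by
  have h := does_forEach (tm := tm) (ι := Bool) (next := .pop .X toCur)
    (body := .seq (.push .Y fun r => r.cur.getD false)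
      (.feed fun r => φ (some (r.cur.getD false))))
    (fun _ _ => True)
    (fun l a o => ⟨⟨o, f, g⟩, [], conts A B R S l a.1 U V O, a.2⟩)
    (fun b l a => ⟨⟨some b, f, g⟩, [], conts A B R S l a.1 U V O, a.2⟩)
    (fun a => ⟨⟨none, f, g⟩, [], conts A B R S [] a.1 U V O, a.2⟩)
    (fun a b => (b :: a.1, φ (some b) :: a.2)) 2
    (fun b l a o _ => (does_pop _ _ _).of (by simp) le_rfl)
    (fun _ _ _ => rfl)
    (fun a o => (does_pop _ _ _).of (by simp) le_rfl)
    (fun _ => rfl)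
    (fun b l a _ => ⟨trivial, some b, ((does_push _ _ _).seq (does_feed _ _)).of
      (by simp) le_rfl⟩)
    X ([], q) o trivial
  have hf : ∀ (X Y : List Bool) (q : List (tm.Γ tm.k₀)),
      X.foldl (fun a b => (b :: a.1, φ (some b) :: a.2)) (Y, q) =
        (X.reverse ++ Y, (X.reverse.map some).map φ ++ q) := by
    intro X
    induction X with
    | nil => intros; rfl
    | cons b X ih => intro Y q; rw [List.foldl_cons, ih]; simp
  rw [hf] at h
  refine (h.seq (does_pour (by decide) _ _ _ _ _ _ _ ?_)).mono ?_
  · simp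
  · simp
    omega

/-- Runs the subroutine on the string on the stack `X` and a block of the stack `R`. -/
def tryBlock (φ : Option Bool → tm.Γ tm.k₀) : Program tm Bool :=
  .seq (loadBlock fun b => φ (some b)) <|
  .seq (.feed fun _ => φ none) <|
  .seq (loadString φ) <|
  .call fun r o => ⟨r.cur, r.found || o.isSome, r.ok⟩

/-- Runs the subroutine on the string on the stack `X` and all blocks of the stack `R`. -/
def tryBlocks (φ : Option Bool → tm.Γ tm.k₀) : Program tm Bool :=
  .seq (forEach (.peek .R toCur) (tryBlock φ)) (pour .S .R)

/-- The input stack of the subroutine is filled from its end: first the block, then the separator,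
then the string. Both strings are reversed on the way, hence the `reverse` in `hrun`. The final
`pour` restores `R` for the next string. -/
theorem does_tryBlocks (φ : Option Bool → tm.Γ tm.k₀) (good : List Bool → Bool)
    (X : List Bool) (cs : List (List Bool)) (s t : ℕ) (hs : 0 < s) (hlen : ∀ b ∈ cs, b.length = s)
    (hrun : ∀ b ∈ cs, ∃ o : Option (tm.Γ tm.k₁), o.isSome = good b ∧ Nonempty (TM2OutputsInTime tm
      ((encodePair X.reverse b.reverse).map φ) (some o.toList) t)) (o : Option Bool) (g : Bool) :
    Does (tryBlocks φ) (cs.length * (s * 9 + X.length * 7 + t + 12) + cs.flatten.length * 3 + 4)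
      ⟨⟨o, false, g⟩, [], conts (List.replicate s true) [] cs.flatten [] X [] [] [] [], []⟩
      ⟨⟨none, cs.any good, g⟩, [],
        conts (List.replicate s true) [] cs.flatten [] X [] [] [] [], []⟩ := by
  have h := does_forEach (tm := tm) (ι := Bool)
    (next := .peek .R toCur) (body := tryBlock φ)
    (fun l _ => ∀ c ∈ l, c ∈ cs)
    (fun l a o => ⟨⟨o, a.1, g⟩, [],
      conts (List.replicate s true) [] l.flatten a.2 X [] [] [] [], []⟩)
    (fun c l a => ⟨⟨some (c.head?.getD false), a.1, g⟩, [],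
      conts (List.replicate s true) [] (c ++ l.flatten) a.2 X [] [] [] [], []⟩)
    (fun a => ⟨⟨none, a.1, g⟩, [],
      conts (List.replicate s true) [] [] a.2 X [] [] [] [], []⟩)
    (fun (a : Bool × List Bool) c => (a.1 || good c, c.reverse ++ a.2))
    (s * 9 + X.length * 7 + t + 10)
    (fun c l a o h => by
      have hc := hlen _ (h c (by simp))
      obtain _ | ⟨b, c⟩ := c
      · exact absurd hc hs.ne
      · exact (does_peek _ _ _).of (by simp) le_rfl)
    (fun _ _ _ => rfl)
    (fun m o => (does_peek _ _ _).of (by simp) le_rfl)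
    (fun _ => rfl)
    (fun c l a h => by
      have hc := hlen _ (h c (by simp))
      obtain ⟨o, ho, hrun⟩ := hrun _ (h c (by simp))
      refine ⟨fun c hc => h c (by simp [hc]), none, ?_⟩
      have h4 := does_loadBlock (tm := tm) (ι := Bool) (fun b => φ (some b)) c
        (some (c.head?.getD false)) a.1 g [] l.flatten a.2 X [] [] [] [] []
      rw [hc, List.append_nil] at h4
      have h5 := does_feed (tm := tm) (ι := Bool) (fun _ => φ none) ⟨⟨none, a.1, g⟩, [],
        conts (List.replicate s true) [] l.flatten (c.reverse ++ a.2) X [] [] [] [],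
        c.reverse.map fun b => φ (some b)⟩
      have h6 := does_loadString φ none a.1 g (List.replicate s true) [] l.flatten
        (c.reverse ++ a.2) X [] [] [] (φ none :: c.reverse.map fun b => φ (some b))
      have h7 := does_call (tm := tm) (ι := Bool)
        (fun r o => ⟨r.cur, r.found || o.isSome, r.ok⟩) ⟨⟨none, a.1, g⟩, [],
        conts (List.replicate s true) [] l.flatten (c.reverse ++ a.2) X [] [] [] [],
        (X.reverse.map some).map φ ++ φ none :: c.reverse.map fun b => φ (some b)⟩ o t
        (by simpa [encodePair, Function.comp_def] using hrun)
      exact (h4.seq <| h5.seq <| h6.seq h7).of (by simp [ho]) (by omega))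
    cs (false, []) o (by simp)
  have e2 : ∀ (l : List (List Bool)) (a : Bool × List Bool),
      (l.foldl (fun (a : Bool × List Bool) c => (a.1 || good c, c.reverse ++ a.2)) a) =
        (a.1 || l.any good, l.flatten.reverse ++ a.2) := by
    intro l
    induction l with
    | nil => simp
    | cons b l ih => intro a; simp [ih, Bool.or_assoc]
  rw [e2] at h
  refine (h.seq (does_pour (by decide) _ _ _ _ _ _ _ ?_)).mono ?_
  · simp
  · simp only [conts, List.append_nil, List.length_reverse]
    have := Nat.mul_add cs.length (s * 9 + X.length * 7 + t + 10) 2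
    have := Nat.mul_add cs.length (s * 9 + X.length * 7 + t + 10 + 2) 0
    ring_nf
    omega

/-- Given a string of length `2 ^ N`, tests whether for all strings `x` of length `N / (c + 1)` the
subroutine decides `x` with the help of some block of length `2 ^ (c * (N / (c + 1)))`. -/
def testProg (c : ℕ) (φ : Option Bool → tm.Γ tm.k₀) : Program tm Bool :=
  .seq (forEach (.read toCur) (.seq (.push .R fun r => r.cur.getD false)
    (.push .U fun _ => true))) <|
  .seq (sizesProg c) <|
  .seq (.load fun _ => ⟨some true, false, true⟩) <|
  .seq (.loop (fun r => r.cur.isSome) <|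
    .seq (tryBlocks φ) <|
    .seq (.load fun r => ⟨r.cur, false, r.ok && r.found⟩)
    increment) <|
  .seq (clear .A) <|
  .seq (clear .R) <|
  .seq (clear .Y) <|
  .seq (.push .out fun r => r.ok) <|
  .load fun _ => Reg.init

/-- A bound on the running time of `testProg` on inputs of length `L`, where `t` is a bound on the
running time of the subroutine. -/
def testTime (c L t : ℕ) : ℕ :=
  (L + 2) * (sizesTime c L + 1) + L * (L * (L * 16 + t + 12) + L * 9 + 20) + L * 13 + 20

/-- A binary counter runs through all `2 ^ n` strings, with `n = N / (c + 1)`, and each is tried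
against all blocks. Both numbers are at most `2 ^ N`, so the number of calls is polynomial in the
length of the table. -/
theorem does_testProg (c N : ℕ) (φ : Option Bool → tm.Γ tm.k₀)
    (good : List Bool → List Bool → Bool) (bs : List (List Bool)) (t : ℕ)
    (hlen : ∀ b ∈ bs, b.length = 2 ^ (c * (N / (c + 1)))) (hN : bs.flatten.length = 2 ^ N)
    (hrun : ∀ x : List Bool, x.length = N / (c + 1) → ∀ b ∈ bs,
      ∃ o : Option (tm.Γ tm.k₁), o.isSome = good x b ∧
        Nonempty (TM2OutputsInTime tm ((encodePair x b).map φ) (some o.toList) t))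
    (res : Bool) (hres : res = true ↔
      ∀ x : List Bool, x.length = N / (c + 1) → ∃ b ∈ bs, good x b = true) :
    Does (testProg c φ) (testTime c (2 ^ N) t) ⟨Reg.init, bs.flatten, fun _ => [], []⟩
      ⟨Reg.init, [], Function.update (fun _ => []) .out [res], []⟩ := by
  have e0 : (fun _ => [] : Aux → List Bool) = conts [] [] [] [] [] [] [] [] [] := by
    funext j; cases j <;> rfl
  set n := N / (c + 1) with hn
  set s := 2 ^ (c * n) with hs
  set cs := (bs.map List.reverse).reverse with hcs
  have hspos : 0 < s := by positivity
  have hcslen : ∀ b ∈ cs, b.length = s := by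
    intro b hb
    rw [hcs] at hb
    simp only [List.mem_reverse, List.mem_map] at hb
    obtain ⟨b, hb, rfl⟩ := hb
    rw [List.length_reverse, hlen b hb]
  have hfl : cs.flatten.length = 2 ^ N := by
    rw [hcs, ← List.reverse_flatten, List.length_reverse, hN]
  have hK : cs.length * s = 2 ^ N := by
    rw [← hfl, List.length_flatten, List.map_congr_left hcslen]
    simp
  have hKle : cs.length ≤ 2 ^ N := hK ▸ Nat.le_mul_of_pos_right _ hspos
  have hnN : n ≤ N := Nat.div_le_self _ _
  have hsN : s ≤ 2 ^ N := by
    apply Nat.pow_le_pow_right (by norm_num)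
    have : n * (c + 1) ≤ N := Nat.div_mul_le_self _ _
    nlinarith
  have hn2 : n ≤ 2 ^ N := hnN.trans N.lt_two_pow_self.le
  have hpn : 2 ^ n ≤ 2 ^ N := Nat.pow_le_pow_right (by norm_num) hnN
  have h1 := does_forEach (tm := tm) (ι := Bool) (next := .read toCur)
    (body := .seq (.push .R fun r => r.cur.getD false) (.push .U fun _ => true))
    (fun _ _ => True)
    (fun l a o => ⟨⟨o, false, false⟩, l, conts [] [] a.1 [] [] [] a.2 [] [], []⟩)
    (fun b l a => ⟨⟨some b, false, false⟩, l, conts [] [] a.1 [] [] [] a.2 [] [], []⟩)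
    (fun a => ⟨⟨none, false, false⟩, [], conts [] [] a.1 [] [] [] a.2 [] [], []⟩)
    (fun a b => (b :: a.1, true :: a.2)) 2
    (fun b l a o _ => (does_read _ _).of (by simp) le_rfl)
    (fun _ _ _ => rfl)
    (fun a o => (does_read _ _).of (by simp) le_rfl)
    (fun _ => rfl)
    (fun b l a _ => ⟨trivial, some b, ((does_push _ _ _).seq (does_push _ _ _)).of
      (by simp) le_rfl⟩)
    bs.flatten ([], []) none trivial
  have hf : ∀ (l R U : List Bool), l.foldl (fun a b => (b :: a.1, true :: a.2)) (R, U) =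
      (l.reverse ++ R, List.replicate l.length true ++ U) := by
    intro l
    induction l with
    | nil => intros; rfl
    | cons b l ih =>
      intro R U
      rw [List.foldl_cons, ih]
      simp [List.replicate_succ']
  rw [hf, hN, List.append_nil, List.append_nil, List.reverse_flatten, ← hcs] at h1
  have h2 := does_sizesProg (tm := tm) c N cs.flatten
  rw [← hn, ← hs] at h2
  let found (i : ℕ) : Bool := cs.any fun b => good (bits n i).reverse b.reverse
  -- State after the first `i` strings: `ok` is the conjunction of their results. At `i = 2 ^ n` the
  -- counter has overflowed, leaving `none` in the register and `n` zeros on `Y`.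
  let st (i : ℕ) : State tm Bool :=
    ⟨⟨if i < 2 ^ n then some true else none, false, (List.range i).all found⟩, [],
      conts (List.replicate s true) [] cs.flatten [] (if i < 2 ^ n then bits n i else [])
        (if i < 2 ^ n then [] else List.replicate n false) [] [] [], []⟩
  have h3 : Does (tm := tm) (ι := Bool) (.load fun _ => ⟨some true, false, true⟩) 1
      ⟨⟨none, false, false⟩, [], conts (List.replicate s true) [] cs.flatten []
        (List.replicate n false) [] [] [] [], []⟩ (st 0) :=
    -- The zeros that record `n` on `X` already form the initial value of the counter.
    (does_load _ _).of (by simp [st, bits_zero]) le_rfl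
  have h4 := does_loop_iterate (tm := tm) (ι := Bool) (b := fun r => r.cur.isSome)
    (p := .seq (tryBlocks φ) <| .seq (.load fun r => ⟨r.cur, false, r.ok && r.found⟩) increment)
    st (2 ^ N * (2 ^ N * 16 + t + 12) + 2 ^ N * 9 + 13) (2 ^ n)
    (by
      intro i hi
      refine ⟨by simp [st, hi], ?_⟩
      have g1 := does_tryBlocks φ (fun b => good (bits n i).reverse b.reverse) (bits n i) cs s t
        hspos hcslen
        (by
          intro b hb
          rw [hcs] at hb
          simp only [List.mem_reverse, List.mem_map] at hb
          obtain ⟨b, hb, rfl⟩ := hb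
          rw [List.reverse_reverse]
          exact hrun _ (by rw [List.length_reverse, length_bits]) b hb)
        (some true) ((List.range i).all found)
      have g2 := does_increment (tm := tm) (ι := Bool) n i hi none false
        ((List.range (i + 1)).all found) [] (List.replicate s true) [] cs.flatten [] [] [] [] []
      have g3 : Does (tm := tm) (ι := Bool) (.load fun r => ⟨r.cur, false, r.ok && r.found⟩) 1
          ⟨⟨none, found i, (List.range i).all found⟩, [],
            conts (List.replicate s true) [] cs.flatten [] (bits n i) [] [] [] [], []⟩
          ⟨⟨none, false, (List.range (i + 1)).all found⟩, [],
            conts (List.replicate s true) [] cs.flatten [] (bits n i) [] [] [] [], []⟩ :=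
        (does_load _ _).of (by simp [List.range_succ]) le_rfl
      have g0 : st i = ⟨⟨some true, false, (List.range i).all found⟩, [],
          conts (List.replicate s true) [] cs.flatten [] (bits n i) [] [] [] [], []⟩ := by
        simp [st, hi]
      rw [g0]
      refine (g1.seq <| g3.seq g2).mono ?_
      rw [length_bits, hfl]
      have := Nat.mul_le_mul hKle (show s * 9 + n * 7 + t + 12 ≤ 2 ^ N * 16 + t + 12 by omega)
      omega)
    (by simp [st])
  have hok : (List.range (2 ^ n)).all found = res := by
    rw [Bool.eq_iff_iff, hres, List.all_eq_true]
    simp only [found, List.mem_range, List.any_eq_true]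
    constructor
    · intro h x hx
      obtain ⟨i, hi, hix⟩ := exists_bits x.reverse
      rw [List.length_reverse, hx] at hi hix
      obtain ⟨b, hb, hg⟩ := h i hi
      rw [hcs] at hb
      simp only [List.mem_reverse, List.mem_map] at hb
      obtain ⟨b, hb, rfl⟩ := hb
      exact ⟨b, hb, by simpa [hix] using hg⟩
    · intro h i hi
      obtain ⟨b, hb, hg⟩ := h (bits n i).reverse (by rw [List.length_reverse, length_bits])
      exact ⟨b.reverse, by simpa [hcs] using hb, by simpa using hg⟩
  have e1 : st (2 ^ n) = ⟨⟨none, false, res⟩, [], conts (List.replicate s true) [] cs.flatten []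
      [] (List.replicate n false) [] [] [], []⟩ := by
    simp [st, hok]
  rw [e1] at h4
  have hc := does_clear (tm := tm) (j := .A) none false res ([] : List Bool)
    (conts (List.replicate s true) [] cs.flatten [] [] (List.replicate n false) [] [] [])
    (conts [] [] cs.flatten [] [] (List.replicate n false) [] [] []) [] (by simp)
  have hd := does_clear (tm := tm) (j := .R) none false res ([] : List Bool)
    (conts [] [] cs.flatten [] [] (List.replicate n false) [] [] [])
    (conts [] [] [] [] [] (List.replicate n false) [] [] []) [] (by simp)
  have he := does_clear (tm := tm) (j := .Y) none false res ([] : List Bool)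
    (conts [] [] [] [] [] (List.replicate n false) [] [] [])
    (conts [] [] [] [] [] [] [] [] []) [] (by simp)
  rw [e0]
  refine (h1.seq <| h2.seq <| h3.seq <| h4.seq <| hc.seq <| hd.seq <| he.seq <|
    (does_push _ _ _).seq <| does_load _ _).of (by simp) ?_
  simp only [conts, hfl, List.length_replicate]
  have := Nat.mul_le_mul_right (2 ^ N * (2 ^ N * 16 + t + 12) + 2 ^ N * 9 + 13 + 1) hpn
  have h5 : 2 ^ N * (2 ^ N * (2 ^ N * 16 + t + 12) + 2 ^ N * 9 + 13 + 1) + 2 ^ N * 6 =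
    2 ^ N * (2 ^ N * (2 ^ N * 16 + t + 12) + 2 ^ N * 9 + 20) := by ring
  simp only [testTime, ← h5]
  omega

theorem exists_test (c : ℕ) (T : TM2ComputableAux (Option Bool) Bool)
    (M : List Bool → List Bool → Option Bool) :
    ∃ T' : TM2ComputableAux Bool Bool, ∀ (N : ℕ) (bs : List (List Bool)) (t : ℕ),
      (∀ b ∈ bs, b.length = 2 ^ (c * (N / (c + 1)))) → bs.flatten.length = 2 ^ N →
      (∀ x : List Bool, x.length = N / (c + 1) → ∀ b ∈ bs, Nonempty (TM2OutputsInTime T.tm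
        ((encodePair x b).map T.inputAlphabet.symm)
        (some ((M x b).toList.map T.outputAlphabet.symm)) t)) →
      ∀ res : Bool, (res = true ↔ ∀ x : List Bool, x.length = N / (c + 1) →
        ∃ b ∈ bs, (M x b).isSome = true) →
      ∀ t', testTime c (2 ^ N) t + 1 ≤ t' →
        Nonempty (TM2OutputsInTime T'.tm (bs.flatten.map T'.inputAlphabet.symm)
          (some ([res].map T'.outputAlphabet.symm)) t') := by
  refine ⟨computer (testProg (tm := T.tm) c T.inputAlphabet.symm), ?_⟩
  intro N bs t hlen hN hrun res hres t' ht
  refine computer_outputs (does_testProg c N _ (fun x b => (M x b).isSome) bs t hlen hN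
    (fun x hx b hb => ⟨(M x b).map T.outputAlphabet.symm, by simp, ?_⟩) res hres) ht
  have h := hrun x hx b hb
  cases hM : M x b <;> simpa [hM] using h

end

end Machine

end NaturalSeeds

namespace NaturalSeeds

/-! ### Truth tables -/

theorem lexString_injective (n : ℕ) : Function.Injective fun i : Fin (2 ^ n) => lexString n i := by
  intro i j h
  apply Fin.ext
  apply Nat.eq_of_testBit_eq
  intro k
  by_cases hk : k < n
  · have := congrFun h ⟨n - 1 - k, by omega⟩
    simp only [lexString] at this
    rwa [show n - 1 - (n - 1 - k) = k by omega] at this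
  · have hp : 2 ^ n ≤ 2 ^ k := Nat.pow_le_pow_right (by norm_num) (by omega)
    rw [Nat.testBit_lt_two_pow (i.2.trans_le hp), Nat.testBit_lt_two_pow (j.2.trans_le hp)]

/-- The lexicographic enumeration of the `n`-bit strings. -/
noncomputable def lexEquiv (n : ℕ) : Fin (2 ^ n) ≃ (Fin n → Bool) :=
  Equiv.ofBijective (fun i => lexString n i)
    ((Fintype.bijective_iff_injective_and_card _).2 ⟨lexString_injective n, by simp⟩)

theorem length_tt {n : ℕ} (f : BoolFun n) : (tt f).length = 2 ^ n := by simp [tt]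

/-- Functions on `n` bits correspond to strings of length `2 ^ n`. -/
noncomputable def ttEquiv (n : ℕ) : BoolFun n ≃ List.Vector Bool (2 ^ n) :=
  ((lexEquiv n).arrowCongr (Equiv.refl Bool)).symm.trans (Equiv.vectorEquivFin _ _).symm

theorem ttEquiv_toList {n : ℕ} (f : BoolFun n) : (ttEquiv n f).toList = tt f :=
  List.Vector.toList_ofFn _

theorem exists_tt_eq {n : ℕ} (l : List Bool) (h : l.length = 2 ^ n) : ∃ f : BoolFun n, tt f = l :=
  let y : List.Vector Bool (2 ^ n) := ⟨l, h⟩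
  ⟨(ttEquiv n).symm y, by rw [← ttEquiv_toList, Equiv.apply_symm_apply]; rfl⟩

theorem tt_injective (n : ℕ) : Function.Injective (tt (n := n)) := by
  intro f g h
  rw [← ttEquiv_toList, ← ttEquiv_toList] at h
  exact (ttEquiv n).injective (Subtype.ext h)

/-- The restriction of a function on `a + b` bits that is given by the values of the first `a`
bits. -/
def block {a b : ℕ} (F : BoolFun (a + b)) (u : Fin a → Bool) : BoolFun b :=
  fun v => F (Fin.append u v)

/-- Strings are indexed with the most significant bit first, so the first `a` bits select a block
and the last `b` bits a position within it. -/
theorem lexString_append (a b i j : ℕ) (hj : j < 2 ^ b) :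
    lexString (a + b) (2 ^ b * i + j) = Fin.append (lexString a i) (lexString b j) := by
  funext p
  refine Fin.addCases (fun p => ?_) (fun p => ?_) p
  · rw [Fin.append_left]
    simp only [lexString, Fin.val_castAdd]
    rw [Nat.testBit_two_pow_mul_add _ hj, if_neg (by omega)]
    congr 1
    omega
  · rw [Fin.append_right]
    simp only [lexString, Fin.val_natAdd]
    rw [Nat.testBit_two_pow_mul_add _ hj, if_pos (by omega)]
    congr 1
    omega

theorem tt_eq_flatten {a b : ℕ} (F : BoolFun (a + b)) :
    tt F = (List.ofFn fun i : Fin (2 ^ a) => tt (block F (lexString a i))).flatten := by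
  unfold tt
  rw [List.ofFn_congr (pow_add 2 a b), List.ofFn_mul]
  congr 2
  funext i
  congr 1
  funext j
  simp only [block]
  rw [← lexString_append _ _ _ _ j.2, Nat.mul_comm (2 ^ b)]
  rfl

theorem mem_blocks_iff {a b : ℕ} (F : BoolFun (a + b)) (p : List Bool → Prop) :
    (∃ l ∈ List.ofFn fun i : Fin (2 ^ a) => tt (block F (lexString a i)), p l) ↔
      ∃ u, p (tt (block F u)) := by
  simp only [List.mem_ofFn, exists_exists_eq_and]
  exact ⟨fun ⟨i, h⟩ => ⟨_, h⟩, fun ⟨u, h⟩ => ⟨(lexEquiv a).symm u, by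
    have : lexString a ((lexEquiv a).symm u) = u := (lexEquiv a).apply_symm_apply u
    rwa [this]⟩⟩

/-- Used to identify an arbitrary division into blocks of equal length with the division into truth
tables of restrictions. -/
theorem eq_of_flatten_eq {α : Type} {s : ℕ} (hs : 0 < s) (ls ls' : List (List α))
    (h : ls.flatten = ls'.flatten) (hl : ∀ l ∈ ls, l.length = s) (hl' : ∀ l ∈ ls', l.length = s) :
    ls = ls' := by
  have hlen : ls.map List.length = ls'.map List.length := by
    rw [List.map_congr_left hl, List.map_congr_left hl']
    have := congrArg List.length h
    rw [List.length_flatten, List.length_flatten, List.map_congr_left hl,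
      List.map_congr_left hl'] at this
    simp at this
    simp [this.resolve_right hs.ne']
  exact List.eq_iff_flatten_eq.2 ⟨h, hlen⟩

/-! ### Densities -/

/-- The fraction of the elements that are contained in a set. -/
noncomputable def density {α : Type} (S : Set α) : ℝ := (Nat.card S : ℝ) / Nat.card α

section

variable {α β : Type}

theorem density_compl [Finite α] [Nonempty α] (S : Set α) : density Sᶜ = 1 - density S := by
  have h : Nat.card S + Nat.card ↑Sᶜ = Nat.card α := Set.ncard_add_ncard_compl S
  have h0 : (Nat.card α : ℝ) ≠ 0 := by exact_mod_cast Nat.card_pos.ne'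
  unfold density
  rw [eq_sub_iff_add_eq, ← add_div, div_eq_one_iff_eq h0]
  exact_mod_cast (Nat.add_comm _ _).trans h

theorem density_mono [Finite α] {S T : Set α} (h : S ⊆ T) : density S ≤ density T := by
  unfold density
  gcongr
  exact Nat.card_mono (Set.toFinite T) h

theorem density_iUnion_le [Finite α] [Fintype β] (S : β → Set α) (r : ℝ)
    (h : ∀ b, density (S b) ≤ r) : density (⋃ b, S b) ≤ Fintype.card β * r := by
  have h1 : ((⋃ b, S b).ncard : ℝ) ≤ ∑ b, ((S b).ncard : ℝ) := by
    exact_mod_cast Set.ncard_iUnion_le_of_fintype S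
  calc density (⋃ b, S b) ≤ (∑ b, ((S b).ncard : ℝ)) / Nat.card α := by
        unfold density; gcongr; exact h1
    _ = ∑ b, density (S b) := by rw [Finset.sum_div]; rfl
    _ ≤ ∑ _b : β, r := Finset.sum_le_sum fun b _ => h b
    _ = _ := by simp

theorem density_preimage (e : α ≃ β) (S : Set β) : density (e ⁻¹' S) = density S := by
  unfold density
  rw [Nat.card_congr e, Nat.card_congr (e.subtypeEquiv (p := (· ∈ e ⁻¹' S)) (q := (· ∈ S))
    fun a => Iff.rfl)]

theorem density_pi [Finite α] [Fintype β] (S : Set α) :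
    density {f : β → α | ∀ b, f b ∈ S} = density S ^ Fintype.card β := by
  unfold density
  have h : Nat.card {f : β → α | ∀ b, f b ∈ S} = Nat.card S ^ Fintype.card β := by
    have e : {f : β → α | ∀ b, f b ∈ S} ≃ (β → S) :=
      Equiv.subtypePiEquivPi (β := fun _ : β => α) (p := fun a => (· ∈ S))
    rw [Nat.card_congr e, Nat.card_fun,
      Nat.card_eq_fintype_card (α := β)]
  rw [h, Nat.card_fun, Nat.card_eq_fintype_card (α := β), div_pow]
  push_cast
  rfl

end

/-- Functions on `a + b` bits correspond to families of functions on `b` bits. -/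
def blockEquiv (a b : ℕ) : BoolFun (a + b) ≃ ((Fin a → Bool) → BoolFun b) :=
  ((Fin.appendEquiv a b).arrowCongr (Equiv.refl Bool)).symm.trans (Equiv.curry _ _ _)

/-- The blocks of a uniformly random function are independent and uniform, so the probabilities
multiply. -/
theorem density_blocks (a b : ℕ) (S : Set (BoolFun b)) :
    density {F : BoolFun (a + b) | ∀ u, block F u ∈ S} = density S ^ 2 ^ a := by
  have h := density_preimage (blockEquiv a b) {f | ∀ u, f u ∈ S}
  rw [density_pi, Fintype.card_fun, Fintype.card_fin, Fintype.card_bool] at h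
  exact h

theorem randProb_eq (b : ℕ) (p : List Bool → Prop) :
    randProb (2 ^ b) p = density {f : BoolFun b | p (tt f)} := by
  have h := density_preimage (ttEquiv b) {y | p y.toList}
  have h1 : ttEquiv b ⁻¹' {y | p y.toList} = {f : BoolFun b | p (tt f)} := by
    ext f
    simp [ttEquiv_toList]
  rw [← h1, h]
  unfold randProb density
  rw [Nat.card_eq_fintype_card (α := List.Vector Bool (2 ^ b)), card_vector]
  simp
  rfl

end NaturalSeeds

namespace NaturalSeeds

/-! ### Restrictions of circuits -/

/-- A gate with renamed wires. -/
def Gate.map {w w' : Type} (φ : w → w') : Gate w → Gate w'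
  | .not a => .not (φ a)
  | .and as => .and (as.map φ)
  | .or as => .or (as.map φ)
  | .maj as => .maj (as.map φ)
  | .mod q as => .mod q (as.map φ)

theorem Gate.eval_map {w w' : Type} (φ : w → w') (v : w' → Bool) (g : Gate w) :
    (g.map φ).eval v = g.eval (v ∘ φ) := by
  cases g <;> simp [Gate.map, Gate.eval, List.all_map, List.any_map, List.countP_map]

theorem Gate.wires_map {w w' : Type} (φ : w → w') (g : Gate w) :
    (g.map φ).wires = g.wires.map φ := by
  cases g <;> rfl

theorem TypicalClass.Allows.map {C : TypicalClass} {m : ℕ} {w w' : Type} (φ : w → w') {g : Gate w}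
    (h : C.Allows m w g) : C.Allows m w' (g.map φ) := by
  cases C <;> cases g <;> simp_all [TypicalClass.Allows, Gate.map]

section

variable {a b : ℕ}

/-- Fixes the first inputs of a circuit. -/
def Wire.restrict (u : Fin a → Bool) {s : ℕ} : Wire (a + b) s → Wire b s
  | .input i => Fin.addCases (motive := fun _ => Wire b s) (fun j => .const (u j)) .input i
  | .const c => .const c
  | .gate j => .gate j

theorem Wire.eval_restrict (u : Fin a → Bool) {s : ℕ} (x : Fin b → Bool) (v : Fin s → Bool)
    (w : Wire (a + b) s) : (w.restrict u).eval x v = w.eval (Fin.append u x) v := by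
  cases w with
  | input i =>
    refine Fin.addCases (fun i => ?_) (fun i => ?_) i <;>
      simp [Wire.restrict, Wire.eval]
  | const c => rfl
  | gate j => rfl

theorem Wire.depth_restrict (u : Fin a → Bool) {s : ℕ} (d : Fin s → ℕ) (w : Wire (a + b) s) :
    (w.restrict u).depth d = w.depth d := by
  cases w with
  | input i =>
    refine Fin.addCases (fun i => ?_) (fun i => ?_) i <;>
      simp [Wire.restrict, Wire.depth]
  | const c => rfl
  | gate j => rfl

/-- Fixes the first inputs of a list of gates. -/
def Gates.restrict (u : Fin a → Bool) : {s : ℕ} → Gates (a + b) s → Gates b s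
  | _, .nil => .nil
  | _, .snoc G g => .snoc (G.restrict u) (g.map (Wire.restrict u))

theorem Gates.vals_restrict (u : Fin a → Bool) (x : Fin b → Bool) {s : ℕ} (G : Gates (a + b) s) :
    (G.restrict u).vals x = G.vals (Fin.append u x) := by
  induction G with
  | nil => rfl
  | snoc G g ih =>
    simp only [Gates.restrict, Gates.vals, ih, Gate.eval_map]
    congr 2
    funext w
    exact Wire.eval_restrict u x _ w

theorem Gates.depths_restrict (u : Fin a → Bool) {s : ℕ} (G : Gates (a + b) s) :
    (G.restrict u).depths = G.depths := by
  induction G with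
  | nil => rfl
  | snoc G g ih =>
    simp only [Gates.restrict, Gates.depths, ih, Gate.wires_map, List.map_map]
    congr 4
    funext w
    exact Wire.depth_restrict u _ w

theorem Gates.all_restrict {C : TypicalClass} {m : ℕ} (u : Fin a → Bool) {s : ℕ}
    {G : Gates (a + b) s} (h : G.All (C.Allows m)) : (G.restrict u).All (C.Allows m) := by
  induction G with
  | nil => trivial
  | snoc G g ih => exact ⟨ih h.1, h.2.map _⟩

/-- Wires may read constants, so fixing the first inputs changes neither the number of gates nor the
depth. Only the bounds have to be compared, as they now refer to `b` inputs instead of `a + b`. -/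
theorem TypicalClass.HasCircuit.block {C : TypicalClass} {d m s d' s' : ℕ} {F : BoolFun (a + b)}
    (h : C.HasCircuit d m s F) (hs : s ≤ s') (hd : C.depthBound d (a + b) ≤ C.depthBound d' b)
    (u : Fin a → Bool) : C.HasCircuit d' m s' (block F u) := by
  obtain ⟨D, hsize, hall, hdepth, rfl⟩ := h
  refine ⟨⟨D.size, D.gates.restrict u, D.out.restrict u⟩, hsize.trans hs, hall |> Gates.all_restrict u,
    le_trans (le_of_eq ?_) (hdepth.trans hd), ?_⟩
  · simp only [Circuit.depth, Gates.depths_restrict, Wire.depth_restrict]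
  · funext x
    simp only [Circuit.eval, Gates.vals_restrict, Wire.eval_restrict, NaturalSeeds.block]

end

theorem hasCircuit_const (C : TypicalClass) (d m s : ℕ) (f : BoolFun 0) : C.HasCircuit d m s f := by
  refine ⟨⟨0, .nil, .const (f Fin.elim0)⟩, Nat.zero_le _, trivial, ?_, ?_⟩
  · simp [Circuit.depth, Wire.depth]
  · funext x
    simp only [Circuit.eval, Wire.eval]
    congr 1
    exact Subsingleton.elim _ _

/-! ### Size and depth bounds -/

/-- A linear change of the number of inputs adds at most the constant `A` to the logarithm, which a
larger depth parameter absorbs. -/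
theorem exists_depthBound_le (C : TypicalClass) (d A : ℕ) :
    ∃ d', ∀ N n : ℕ, 0 < n → N ≤ A * n → C.depthBound d N ≤ C.depthBound d' n := by
  have hlog : ∀ N n : ℕ, 0 < n → N ≤ A * n → Nat.log 2 N ≤ Nat.log 2 n + A := by
    intro N n hn h
    have h1 : N ≤ n * 2 ^ A := by
      rw [Nat.mul_comm]
      exact h.trans (Nat.mul_le_mul_right _ A.lt_two_pow_self.le)
    calc Nat.log 2 N ≤ Nat.log 2 (n * 2 ^ A) := Nat.log_mono_right h1
      _ = _ := by
        clear h h1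
        induction A with
        | zero => simp
        | succ A ih =>
          rw [pow_succ, ← Nat.mul_assoc, Nat.log_mul_base (by norm_num) (by positivity), ih]
          omega
  cases C with
  | AC0 => exact ⟨d, fun _ _ _ _ => le_rfl⟩
  | ACC => exact ⟨d, fun _ _ _ _ => le_rfl⟩
  | TC0 => exact ⟨d, fun _ _ _ _ => le_rfl⟩
  | Ppoly => exact ⟨d, fun _ _ _ _ => le_rfl⟩
  | NC1 =>
    refine ⟨d + d * A, fun N n hn h => ?_⟩
    simp only [TypicalClass.depthBound, Nat.cast_le]
    calc d * Nat.log 2 N + d ≤ d * (Nat.log 2 n + A) + d := by gcongr; exact hlog N n hn h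
      _ = d * Nat.log 2 n + (d + d * A) := by ring
      _ ≤ _ := by gcongr; omega
  | NC =>
    refine ⟨d + d * (A + 1) ^ d, fun N n hn h => ?_⟩
    simp only [TypicalClass.depthBound, Nat.cast_le]
    have h1 : d * Nat.log 2 N ^ d ≤ d * (Nat.log 2 n + A) ^ d := by gcongr; exact hlog N n hn h
    -- Raising the exponent of `Nat.log 2 n` needs a positive base; for base zero the additive term
    -- of the bound suffices.
    rcases Nat.eq_zero_or_pos (Nat.log 2 n) with h0 | h0
    · rw [h0, Nat.zero_add] at h1
      have h2 : d * A ^ d ≤ d * (A + 1) ^ d := by gcongr; omega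
      omega
    · have h2 : Nat.log 2 n + A ≤ Nat.log 2 n * (A + 1) := by nlinarith
      have h3 : d * (Nat.log 2 n + A) ^ d ≤ d * (Nat.log 2 n * (A + 1)) ^ d := by gcongr
      have h4 : Nat.log 2 n ^ d ≤ Nat.log 2 n ^ (d + d * (A + 1) ^ d) :=
        Nat.pow_le_pow_right h0 (by omega)
      have h5 : d * (Nat.log 2 n * (A + 1)) ^ d = d * (A + 1) ^ d * Nat.log 2 n ^ d := by
        rw [mul_pow]; ring
      have h6 : d * (A + 1) ^ d * Nat.log 2 n ^ d ≤
          (d + d * (A + 1) ^ d) * Nat.log 2 n ^ (d + d * (A + 1) ^ d) :=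
        Nat.mul_le_mul (by omega) h4
      omega

theorem exists_pow_le (k A : ℕ) : ∃ k', ∀ N n : ℕ, 2 ≤ n → N ≤ A * n → N ^ k ≤ n ^ k' := by
  refine ⟨A * k + k, fun N n hn h => ?_⟩
  calc N ^ k ≤ (A * n) ^ k := Nat.pow_le_pow_left h k
    _ = A ^ k * n ^ k := mul_pow _ _ _
    _ ≤ (2 ^ A) ^ k * n ^ k := by gcongr; exact A.lt_two_pow_self.le
    _ ≤ (n ^ A) ^ k * n ^ k := by gcongr
    _ = n ^ (A * k + k) := by rw [← pow_mul, ← pow_add]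

theorem pow_add_le {k n : ℕ} (hn : 2 ≤ n) : n ^ k + k ≤ n ^ (k + 1) := by
  have h : k ≤ n ^ k := (Nat.lt_two_pow_self (n := k)).le.trans (Nat.pow_le_pow_left hn k)
  rw [pow_succ]
  nlinarith

end NaturalSeeds

namespace NaturalSeeds

open Turing Filter

/-! ### Monotonicity of time bounds, and largeness as a density -/

theorem outputsInTime_mono {tm : FinTM2} {l : List (tm.Γ tm.k₀)} {l' : Option (List (tm.Γ tm.k₁))}
    {s t : ℕ} (h : Nonempty (TM2OutputsInTime tm l l' s)) (hst : s ≤ t) :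
    Nonempty (TM2OutputsInTime tm l l' t) :=
  h.map fun h => ⟨h.toEvalsTo, h.steps_le_m.trans hst⟩

theorem eval_mono_nat (p : Polynomial ℕ) {m n : ℕ} (h : m ≤ n) : p.eval m ≤ p.eval n := by
  rw [Polynomial.eval_eq_sum_range, Polynomial.eval_eq_sum_range]
  gcongr

theorem Large.density_le {P : BoolProperty} (h : Large P) :
    ∃ d : ℕ, ∀ n : ℕ, 1 / 2 ^ (d * n + d) ≤ density (P n) := h

/-! ### From predicates without seeds to natural properties -/

section

variable {L : Set (List Bool)} {c : ℕ} {M : List Bool → List Bool → Option Bool}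

/-- The functions whose truth table contains, for every string `x` of a suitable length, a block
that decides `x`. -/
def seedProperty (c : ℕ) (M : List Bool → List Bool → Option Bool) : BoolProperty := fun N =>
  {F | ∃ bs : List (List Bool), bs.flatten = tt F ∧ (∀ b ∈ bs, b.length = 2 ^ (c * (N / (c + 1)))) ∧
    ∀ x : List Bool, x.length = N / (c + 1) → ∃ b ∈ bs, (M x b).isSome = true}

theorem length_of_mem_blocks {a b : ℕ} {F : BoolFun (a + b)} {l : List Bool}
    (h : l ∈ List.ofFn fun i : Fin (2 ^ a) => tt (block F (lexString a i))) :
    l.length = 2 ^ b := by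
  obtain ⟨i, rfl⟩ := List.mem_ofFn.1 h
  exact length_tt _

theorem mem_seedProperty_iff {a n : ℕ} (hn : (a + c * n) / (c + 1) = n)
    (F : BoolFun (a + c * n)) : F ∈ seedProperty c M (a + c * n) ↔
      ∀ x : List Bool, x.length = n → ∃ u, (M x (tt (block F u))).isSome = true := by
  have h0 x := mem_blocks_iff F fun l => (M x l).isSome = true
  simp only [← h0]
  simp only [seedProperty, hn, Set.mem_ofPred_eq]
  constructor
  · rintro ⟨bs, hbs, hlen, h⟩
    rw [tt_eq_flatten] at hbs
    rwa [eq_of_flatten_eq (by positivity) _ _ hbs hlen fun l hl => length_of_mem_blocks hl] at h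
  · intro h
    exact ⟨_, (tt_eq_flatten F).symm, fun l hl => length_of_mem_blocks hl, h⟩

/-- The last `c * n` bits index positions in a random string for inputs of length `n`, and `n ≤ a`
guarantees enough blocks for a union bound over all such inputs. -/
theorem exists_eq_add (c N : ℕ) : ∃ a n, N = a + c * n ∧ N / (c + 1) = n ∧ n ≤ a := by
  have h := Nat.div_mul_le_self N (c + 1)
  rw [Nat.mul_succ] at h
  refine ⟨N - c * (N / (c + 1)), N / (c + 1), ?_, rfl, ?_⟩ <;>
    · generalize N / (c + 1) = n at *
      rw [Nat.mul_comm n] at h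
      omega

theorem IsZPEPredicate.density_none_le (hM : IsZPEPredicate L c M) {n : ℕ} {x : List Bool}
    (hx : x.length = n) :
    density {f : BoolFun (c * n) | (M x (tt f)).isSome = true}ᶜ ≤ 1 / 3 := by
  have key : ∀ b, 2 / 3 ≤ randProb (2 ^ (c * x.length)) (fun y => M x y = some b) →
      2 / 3 ≤ density {f : BoolFun (c * n) | (M x (tt f)).isSome = true} := by
    intro b h
    rw [hx, randProb_eq] at h
    refine h.trans (density_mono fun f hf => ?_)
    simp only [Set.mem_ofPred_eq] at hf ⊢
    rw [hf, Option.isSome_some]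
  have h : 2 / 3 ≤ density {f : BoolFun (c * n) | (M x (tt f)).isSome = true} := by
    by_cases h : x ∈ L
    · exact key _ (hM.accept x h).1
    · exact key _ (hM.reject x h).1
  rw [density_compl]
  linarith

/-- A function is rejected only if some `x` is undecided by all `2 ^ a` independent blocks. The
union bound gives at most `2 ^ n * (1 / 3) ^ 2 ^ a`, which is at most `3 ^ n * (1 / 3) ^ (n + 1) = 1
/ 3`. -/
theorem IsZPEPredicate.density_seedProperty (hM : IsZPEPredicate L c M) (N : ℕ) :
    2 / 3 ≤ density (seedProperty c M N) := by
  obtain ⟨a, n, rfl, hn, hna⟩ := exists_eq_add c N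
  have h1 : (seedProperty c M (a + c * n))ᶜ ⊆ ⋃ v : List.Vector Bool n, {F : BoolFun (a + c * n) |
      ∀ u, block F u ∈ {f : BoolFun (c * n) | (M v.toList (tt f)).isSome = true}ᶜ} := by
    intro F hF
    rw [Set.mem_compl_iff, mem_seedProperty_iff hn] at hF
    push Not at hF
    obtain ⟨x, hx, h⟩ := hF
    rw [Set.mem_iUnion]
    exact ⟨⟨x, hx⟩, fun u hu => h u hu⟩
  have h2 := density_iUnion_le (fun v : List.Vector Bool n => {F : BoolFun (a + c * n) |
      ∀ u, block F u ∈ {f : BoolFun (c * n) | (M v.toList (tt f)).isSome = true}ᶜ})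
      ((1 / 3) ^ 2 ^ a) fun v => by
    rw [density_blocks]
    gcongr
    · unfold density; positivity
    · exact hM.density_none_le v.toList_length
  have h3 : (Fintype.card (List.Vector Bool n) : ℝ) * (1 / 3) ^ 2 ^ a ≤ 1 / 3 := by
    rw [card_vector, Fintype.card_bool]
    have h4 : n + 1 ≤ 2 ^ a := (Nat.lt_two_pow_self (n := n)).trans_le
      (Nat.pow_le_pow_right (by norm_num) hna)
    calc ((2 ^ n : ℕ) : ℝ) * (1 / 3) ^ 2 ^ a ≤ (3 : ℝ) ^ n * (1 / 3) ^ (n + 1) := by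
          push_cast
          gcongr ?_ * ?_
          · gcongr; norm_num
          · exact pow_le_pow_of_le_one (by norm_num) (by norm_num) h4
      _ = 1 / 3 := by rw [pow_succ, ← mul_assoc, ← mul_pow]; norm_num
  have h5 := (density_mono h1).trans (h2.trans h3)
  rw [density_compl] at h5
  linarith

theorem IsZPEPredicate.large_seedProperty (hM : IsZPEPredicate L c M) :
    Large (seedProperty c M) := by
  refine ⟨1, fun n => le_trans ?_ (hM.density_seedProperty n)⟩
  rw [div_le_iff₀ (by positivity)]
  have : (2 : ℝ) ^ 1 ≤ 2 ^ (1 * n + 1) := pow_le_pow_right₀ (by norm_num) (by omega)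
  linarith

theorem IsZPEPredicate.pconstructive_seedProperty (hM : IsZPEPredicate L c M) :
    PConstructive (seedProperty c M) := by
  classical
  obtain ⟨T, p, e, hT⟩ := hM.time
  obtain ⟨T', hT'⟩ := Machine.exists_test c T M
  -- The polynomial `q` is `testTime` plus one as a function of the table length, with `p * X ^ e`
  -- as the time of a call: block lengths and `2 ^ n` are both at most `2 ^ N`.
  let X : Polynomial ℕ := Polynomial.X
  let σ : Polynomial ℕ := (c : Polynomial ℕ) * (X * 10 + 4) + ((c : Polynomial ℕ) + 1) * (X * 8 + 5) + 5
  let q : Polynomial ℕ := (X + 2) * (σ + 1) + X * (X * (X * 16 + p * X ^ e + 12) + X * 9 + 20) +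
    X * 13 + 20 + 1
  have hq : ∀ l, q.eval l = Machine.testTime c l (p.eval l * l ^ e) + 1 := by
    intro l
    simp [q, σ, X, Machine.testTime, Machine.sizesTime]
  refine ⟨⟨T', q, fun F => ?_⟩⟩
  obtain ⟨N, F⟩ := F
  apply Classical.choice
  obtain ⟨a, n, rfl, hn, hna⟩ := exists_eq_add c N
  rw [length_tt, hq]
  have h := hT' (a + c * n) (List.ofFn fun i : Fin (2 ^ a) => tt (block F (lexString a i)))
    (p.eval (2 ^ (a + c * n)) * (2 ^ (a + c * n)) ^ e)
    (by rw [hn]; exact fun l hl => length_of_mem_blocks hl)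
    (by rw [← tt_eq_flatten, length_tt])
    (by
      intro x hx b hb
      rw [hn] at hx
      have hb := length_of_mem_blocks hb
      refine outputsInTime_mono (hT x b (by rw [hb, hx])) ?_
      rw [hb, hx, Nat.mul_comm e, pow_mul 2 n e]
      exact Nat.mul_le_mul (eval_mono_nat p (Nat.pow_le_pow_right Nat.two_pos (by omega)))
        (Nat.pow_le_pow_left (Nat.pow_le_pow_right Nat.two_pos (by omega)) e))
    (decide (F ∈ seedProperty c M (a + c * n)))
    (by
      rw [decide_eq_true_iff, mem_seedProperty_iff hn, hn]
      have h0 x := mem_blocks_iff F fun l => (M x l).isSome = true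
      simp only [h0])
    _ le_rfl
  rw [← tt_eq_flatten] at h
  exact h

/-- For `c = 0` the seeds are functions without inputs, and a constant wire computes them. This case
is separate because depth bounds at `c * n` inputs are comparable with those at `N` only if `c` is
positive. -/
theorem hasSeedsAt_zero (hM : IsZPEPredicate L 0 M) (C : TypicalClass) (k d m n : ℕ) :
    HasSeedsAt C 0 M k d m n := by
  intro x hx
  have h := hM.density_none_le hx
  rw [density_compl] at h
  obtain ⟨f, hf⟩ : {f : BoolFun (0 * n) | (M x (tt f)).isSome = true}.Nonempty := by
    by_contra hne
    rw [Set.not_nonempty_iff_eq_empty] at hne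
    rw [hne] at h
    norm_num [density] at h
  refine ⟨f, ?_, Option.isSome_iff_ne_none.1 hf⟩
  revert f
  rw [Nat.zero_mul]
  exact fun f _ => hasCircuit_const C d m _ f

/-- A single easy function with the property provides seeds for all `x` at once: for each `x`, some
restriction of it decides `x`, and that restriction is easy too. -/
theorem IsZPEPredicate.usefulAt_or_hasSeedsAt (hM : IsZPEPredicate L c M) (C : TypicalClass)
    (k d m : ℕ) : ∃ k' d' : ℕ, ∀ N : ℕ, 2 ≤ N / (c + 1) →
      UsefulAt C (seedProperty c M) k d m N ∨ HasSeedsAt C c M k' d' m (N / (c + 1)) := by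
  rcases Nat.eq_zero_or_pos c with rfl | hc
  · exact ⟨0, 0, fun N _ => .inr (hasSeedsAt_zero hM C 0 0 m _)⟩
  -- With `n = N / (c + 1)` positive, `N < (n + 1) * (c + 1) ≤ 2 * (c + 1) * n`.
  obtain ⟨k', hk⟩ := exists_pow_le k (2 * (c + 1))
  obtain ⟨d', hd⟩ := exists_depthBound_le C d (2 * (c + 1))
  refine ⟨k', d', fun N hN => or_iff_not_imp_right.2 fun hs => ⟨?_, fun F hF hFP => hs ?_⟩⟩
  · by_contra hne
    have h := hM.density_seedProperty N
    rw [← Set.Nonempty, Set.not_nonempty_iff_eq_empty] at hne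
    rw [hne] at h
    norm_num [density] at h
  · have hlt : N < (N / (c + 1) + 1) * (c + 1) :=
      (Nat.div_lt_iff_lt_mul (by omega)).1 (Nat.lt_succ_self _)
    obtain ⟨a, n, rfl, hn, hna⟩ := exists_eq_add c N
    rw [hn] at hlt hN ⊢
    have hle : a + c * n ≤ 2 * (c + 1) * n := by nlinarith
    intro x hx
    obtain ⟨u, hu⟩ := (mem_seedProperty_iff hn F).1 hFP x hx
    refine ⟨block F u, hF.block ((hk _ n hN hle).trans (Nat.le_add_right _ _)) ?_ u,
      Option.isSome_iff_ne_none.1 hu⟩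
    exact hd _ _ (by positivity) (hle.trans (Nat.mul_le_mul_left _ (Nat.le_mul_of_pos_left _ hc)))

end

/-! ### From natural properties to predicates without seeds -/

section

variable {P : BoolProperty}

/-- The truth tables of the functions with a property. -/
def IsTable (P : BoolProperty) (l : List Bool) : Prop := ∃ n, ∃ f : BoolFun n, f ∈ P n ∧ tt f = l

theorem isTable_tt {n : ℕ} (f : BoolFun n) : IsTable P (tt f) ↔ f ∈ P n := by
  refine ⟨?_, fun h => ⟨n, f, h, rfl⟩⟩
  rintro ⟨n', f', hf', h⟩
  have hlen := congrArg List.length h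
  rw [length_tt, length_tt] at hlen
  obtain rfl := Nat.pow_right_injective le_rfl hlen
  rwa [← tt_injective _ h]

open Classical in
/-- Accepts `(x, y)` if `x` is empty or a block of `y` is the truth table of a function with the
property `P`. -/
noncomputable def hardSearch (P : BoolProperty) (x y : List Bool) : Option Bool :=
  if x = [] ∨ ∃ bs : List (List Bool), bs.flatten = y ∧ (∀ b ∈ bs, b.length = 2 ^ x.length) ∧
    ∃ b ∈ bs, IsTable P b then some true else none

theorem exists_blocks_iff {a n : ℕ} (F : BoolFun (a + n)) :
    (∃ bs : List (List Bool), bs.flatten = tt F ∧ (∀ b ∈ bs, b.length = 2 ^ n) ∧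
      ∃ b ∈ bs, IsTable P b) ↔ ∃ u, block F u ∈ P n := by
  have h0 := mem_blocks_iff F (IsTable P)
  simp only [isTable_tt] at h0
  rw [← h0]
  constructor
  · rintro ⟨bs, hbs, hlen, h⟩
    rw [tt_eq_flatten] at hbs
    rwa [eq_of_flatten_eq (by positivity) _ _ hbs hlen fun l hl => length_of_mem_blocks hl] at h
  · intro h
    exact ⟨_, (tt_eq_flatten F).symm, fun l hl => length_of_mem_blocks hl, h⟩

theorem hardSearch_tt {a : ℕ} (x : List Bool) (F : BoolFun (a + x.length)) :
    hardSearch P x (tt F) ≠ none ↔ x = [] ∨ ∃ u, block F u ∈ P x.length := by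
  unfold hardSearch
  rw [exists_blocks_iff]
  simp
  tauto

theorem hardSearch_eq_or (x y : List Bool) :
    hardSearch P x y = some true ∨ hardSearch P x y = none := by
  unfold hardSearch
  split_ifs <;> simp

theorem expTimeComputable_hardSearch (hP : PConstructive P) (e : ℕ) :
    ExpTimeComputable (e + 1) (hardSearch P) := by
  classical
  obtain ⟨T, time, hT⟩ := hP
  obtain ⟨T', hT'⟩ := Machine.exists_search T fun b => decide (IsTable P b)
  -- There are at most `|y|` blocks, a call costs at most `time` at `|y|`, and the factor `2 ^ (2 *
  -- |x|)` absorbs the cost of handling blocks and of computing `2 ^ |x|` in unary.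
  refine ⟨T', 50 + Polynomial.X * (30 + time), 2, fun x y hy => ?_⟩
  have he : (e + 1) * x.length = e * x.length + x.length := by ring
  rw [he] at hy
  obtain ⟨F, rfl⟩ := exists_tt_eq y hy
  have h := hT' x (List.ofFn fun i : Fin (2 ^ (e * x.length)) => tt (block F (lexString _ i)))
    (time.eval (2 ^ x.length)) (fun l hl => length_of_mem_blocks hl)
    (by
      intro b hb
      obtain ⟨i, rfl⟩ := List.mem_ofFn.1 hb
      have h := hT ⟨_, block F (lexString (e * x.length) i)⟩
      rw [length_tt] at h
      simp only [isTable_tt]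
      exact ⟨h⟩)
    ((50 + Polynomial.X * (30 + time)).eval (tt F).length * 2 ^ (2 * x.length))
    (by
      rw [← tt_eq_flatten, length_tt, List.length_ofFn]
      simp only [Polynomial.eval_add, Polynomial.eval_mul, Polynomial.eval_X,
        Polynomial.eval_ofNat, Machine.searchTime]
      have h1 : x.length ≤ 2 ^ x.length := Nat.lt_two_pow_self.le
      have h2 : 1 ≤ 2 ^ x.length := Nat.one_le_two_pow
      have h3 : time.eval (2 ^ x.length) ≤ time.eval (2 ^ (e * x.length + x.length)) :=
        eval_mono_nat _ (Nat.pow_le_pow_right (by norm_num) (by omega))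
      have h4 : 2 ^ (e * x.length) ≤ 2 ^ (e * x.length + x.length) :=
        Nat.pow_le_pow_right (by norm_num) (by omega)
      have h5 : 2 ^ (2 * x.length) = 2 ^ x.length * 2 ^ x.length := by rw [two_mul, pow_add]
      rw [h5]
      generalize 2 ^ x.length = E at *
      generalize 2 ^ (e * x.length + x.length) = K at *
      generalize 2 ^ (e * x.length) = k at *
      generalize time.eval K = τ at *
      have h6 : E ≤ E * E := Nat.le_mul_of_pos_left _ h2
      have h7 : x.length * (E * 10 + 7) ≤ 17 * (E * E) :=
        (Nat.mul_le_mul h1 (show E * 10 + 7 ≤ 17 * E by omega)).trans (by ring_nf; omega)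
      have h8 : k * (E * 9 + time.eval E + 7) ≤ K * ((16 + τ) * (E * E)) := by
        refine Nat.mul_le_mul h4 ?_
        have : τ ≤ τ * (E * E) := Nat.le_mul_of_pos_right _ (by positivity)
        rw [Nat.add_mul]
        omega
      have h9 : K * 6 ≤ K * (6 * (E * E)) := Nat.mul_le_mul_left _ (by omega)
      have h10 : (50 + K * (30 + τ)) * (E * E) =
        50 * (E * E) + K * ((16 + τ) * (E * E)) + K * (6 * (E * E)) + K * (8 * (E * E)) := by ring
      omega)
  rw [← tt_eq_flatten] at h
  convert h using 3
  have h11 := mem_blocks_iff F (IsTable P)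
  have h12 := exists_blocks_iff (P := P) F
  simp only [isTable_tt] at h11
  unfold hardSearch
  simp only [decide_eq_true_iff, h11, h12]
  split_ifs <;> rfl

/-- Since `(1 - δ) * (1 + δ) ≤ 1`, Bernoulli's inequality bounds the power by `1 / (1 + m * δ)`. -/
theorem pow_one_sub_le {δ : ℝ} {m : ℕ} (h0 : 0 ≤ δ) (h1 : δ ≤ 1) (h : 2 ≤ m * δ) :
    (1 - δ) ^ m ≤ 1 / 3 := by
  have h2 : 1 + m * δ ≤ (1 + δ) ^ m := one_add_mul_le_pow (by linarith) m
  have h3 : (1 - δ) ^ m * (1 + δ) ^ m ≤ 1 := by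
    rw [← mul_pow]
    exact pow_le_one₀ (by nlinarith) (by nlinarith)
  have h4 : 0 ≤ (1 - δ) ^ m := pow_nonneg (by linarith) m
  nlinarith

/-- There are `2 ^ ((2 * d + 1) * n)` independent blocks, each in `P` with probability at least `1 /
2 ^ (d * n + d)`. For `n ≥ 1` the expected number of hits is at least `2`, because `(2 * d + 1) * n
≥ d * n + d + 1`. For `n = 0` there is only one block, which is why the empty string is accepted
outright. -/
theorem isZPEPredicate_hardSearch (hP : PConstructive P) {d : ℕ}
    (hd : ∀ n : ℕ, 1 / 2 ^ (d * n + d) ≤ density (P n)) :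
    IsZPEPredicate Set.univ (2 * d + 1 + 1) (hardSearch P) := by
  refine ⟨expTimeComputable_hardSearch hP _, fun x _ => ⟨?_, fun y _ => hardSearch_eq_or x y⟩,
    fun x hx => absurd (Set.mem_univ x) hx⟩
  have he : (2 * d + 1 + 1) * x.length = (2 * d + 1) * x.length + x.length := by ring
  rw [he, randProb_eq]
  have h1 : {F : BoolFun ((2 * d + 1) * x.length + x.length) | hardSearch P x (tt F) = some true} =
      {F | x = [] ∨ ∃ u, block F u ∈ P x.length} := by
    ext F
    rw [Set.mem_ofPred_eq, Set.mem_ofPred_eq, ← hardSearch_tt]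
    rcases hardSearch_eq_or (P := P) x (tt F) with h | h <;> simp [h]
  rw [h1]
  have h2 : density {F : BoolFun ((2 * d + 1) * x.length + x.length) |
      x = [] ∨ ∃ u, block F u ∈ P x.length}ᶜ ≤ 1 / 3 := by
    by_cases hx : x = []
    · simp only [hx, true_or, Set.ofPred_true, Set.compl_univ]
      norm_num [density]
    · have h3 : {F : BoolFun ((2 * d + 1) * x.length + x.length) |
          x = [] ∨ ∃ u, block F u ∈ P x.length}ᶜ = {F | ∀ u, block F u ∈ (P x.length)ᶜ} := by
        ext F
        simp [hx]
      rw [h3, density_blocks, density_compl]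
      have hδ0 : 0 ≤ density (P x.length) := by unfold density; positivity
      have hδ1 : 0 ≤ density (P x.length)ᶜ := by unfold density; positivity
      rw [density_compl] at hδ1
      refine pow_one_sub_le hδ0 (by linarith) ?_
      have hpos : 0 < x.length := List.length_pos_iff.2 hx
      push_cast
      calc (2 : ℝ) = 2 ^ (d * x.length + d + 1) * (1 / 2 ^ (d * x.length + d)) := by
            rw [pow_succ]; field_simp
        _ ≤ 2 ^ ((2 * d + 1) * x.length) * density (P x.length) := by
            gcongr
            · norm_num
            · nlinarith
            · exact hd _
  rw [density_compl] at h2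
  linarith

/-- A seed for one nonempty string of length `n`, here the zero string, contains a block in `P n`.
As a restriction of the seed it has a circuit of size `n ^ k + k ≤ n ^ (k + 1)`, which contradicts
usefulness. -/
theorem not_usefulAt_of_hasSeedsAt (C : TypicalClass) (e k d m : ℕ) :
    ∃ k' d' : ℕ, ∀ n : ℕ, 2 ≤ n → HasSeedsAt C (e + 1) (hardSearch P) k d m n →
      ¬ UsefulAt C P k' d' m n := by
  obtain ⟨d', hd⟩ := exists_depthBound_le C d (e + 1)
  refine ⟨k + 1, d', fun n hn hs hu => ?_⟩
  obtain ⟨f, hf, hfM⟩ := hs (List.replicate n false) (by simp)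
  have he : (e + 1) * n = e * n + n := by ring
  have hd := hd ((e + 1) * n) n (by omega) le_rfl
  revert f
  rw [he] at hd ⊢
  intro F hF hFM
  have h := hardSearch_tt (P := P) (a := e * n) (List.replicate n false)
  rw [List.length_replicate] at h
  obtain h0 | ⟨u, hu'⟩ := (h F).1 hFM
  · simp at h0
    omega
  · exact hu.2 _ (hF.block (pow_add_le hn) hd u) hu'

end

/-! ### The two translations, and the equivalences -/

theorem exists_natural_of_predicate {L : Set (List Bool)} {c : ℕ}
    {M : List Bool → List Bool → Option Bool} (hM : IsZPEPredicate L c M) (C : TypicalClass) :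
    ∃ P : BoolProperty, PConstructive P ∧ Large P ∧
      ∀ k d m : ℕ, ∃ k' d' : ℕ, ∀ N : ℕ, 2 ≤ N / (c + 1) →
        ¬ HasSeedsAt C c M k' d' m (N / (c + 1)) → UsefulAt C P k d m N := by
  refine ⟨seedProperty c M, hM.pconstructive_seedProperty, hM.large_seedProperty, fun k d m => ?_⟩
  obtain ⟨k', d', h⟩ := hM.usefulAt_or_hasSeedsAt C k d m
  exact ⟨k', d', fun N hN hs => (h N hN).resolve_right hs⟩

theorem exists_predicate_of_natural {P : BoolProperty} (hP : PConstructive P) (hL : Large P)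
    (C : TypicalClass) : ∃ L c M, IsZPEPredicate L c M ∧ ∀ k d m : ℕ, ∃ k' d' : ℕ, ∀ n : ℕ, 2 ≤ n →
      HasSeedsAt C c M k d m n → ¬ UsefulAt C P k' d' m n := by
  obtain ⟨d, hd⟩ := hL.density_le
  exact ⟨_, _, _, isZPEPredicate_hardSearch hP hd, not_usefulAt_of_hasSeedsAt C _⟩

end NaturalSeeds

theorem theorem1p6 (C : NaturalSeeds.TypicalClass) :
    (¬ NaturalSeeds.ExistsIONatural C ↔ NaturalSeeds.ZPEHasSeedsAE C) ∧
    (¬ NaturalSeeds.ExistsAENatural C ↔ NaturalSeeds.ZPEHasSeedsIO C) := by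
  refine ⟨⟨fun h L c M hM => ?_, ?_⟩, ⟨fun h L c M hM => ?_, ?_⟩⟩
  · by_contra hs
    push Not at hs
    obtain ⟨P, hP, hL, hu⟩ := NaturalSeeds.exists_natural_of_predicate hM C
    refine h ⟨P, hP, hL, fun k d m => ?_⟩
    obtain ⟨k', d', hu⟩ := hu k d m
    -- Infinitely many lengths `n` without seeds yield infinitely many useful lengths `N = (c + 1) *
    -- n`, at which `N / (c + 1) = n`.
    have ht : Filter.Tendsto (fun n => (c + 1) * n) Filter.atTop Filter.atTop :=
      Filter.tendsto_id.const_mul_atTop' (by omega)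
    refine ht.frequently (((hs k' d' m).and_eventually (Filter.eventually_ge_atTop 2)).mono ?_)
    rintro n ⟨hn, hn2⟩
    have e : (c + 1) * n / (c + 1) = n := Nat.mul_div_cancel_left n (by omega)
    exact hu _ (by rwa [e]) (by rwa [e])
  · rintro hs ⟨P, hP, hL, hu⟩
    obtain ⟨L, c, M, hM, h⟩ := NaturalSeeds.exists_predicate_of_natural hP hL C
    obtain ⟨k, d, m, hs⟩ := hs L c M hM
    obtain ⟨k', d', h⟩ := h k d m
    obtain ⟨n, hn, hn', hn2⟩ := ((hu k' d' m).and_eventually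
      (hs.and (Filter.eventually_ge_atTop 2))).exists
    exact h n hn2 hn' hn
  · by_contra hs
    push Not at hs
    obtain ⟨P, hP, hL, hu⟩ := NaturalSeeds.exists_natural_of_predicate hM C
    refine h ⟨P, hP, hL, fun k d m => ?_⟩
    obtain ⟨k', d', hu⟩ := hu k d m
    -- Here every large `N` has to be useful, and `N / (c + 1)` tends to infinity, so it lies among
    -- the lengths without seeds.
    have ht : Filter.Tendsto (fun N => N / (c + 1)) Filter.atTop Filter.atTop :=
      Nat.tendsto_div_const_atTop (by omega)
    filter_upwards [ht.eventually (hs k' d' m), ht.eventually (Filter.eventually_ge_atTop 2)] with N h1 h2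
    exact hu N h2 h1
  · rintro hs ⟨P, hP, hL, hu⟩
    obtain ⟨L, c, M, hM, h⟩ := NaturalSeeds.exists_predicate_of_natural hP hL C
    obtain ⟨k, d, m, hs⟩ := hs L c M hM
    obtain ⟨k', d', h⟩ := h k d m
    obtain ⟨n, hn, hn', hn2⟩ := (hs.and_eventually
      ((hu k' d' m).and (Filter.eventually_ge_atTop 2))).exists
    exact h n hn2 hn hn'
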